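/- Let $M=\mathbb{Z}^2$, let $N=\operatorname{Hom}(M,\mathbb{Z})$, and let $X$ be the complete toric surface over $\mathbb{C}$ of a complete fan $\Sigma$ in $M_{\mathbb{R}}$, that is, the surface glued from the affine varieties $\operatorname{Spec}\mathbb{C}[\sigma^\vee\cap N]$, $\sigma\in\Sigma$. A \emph{line} in $X$ is a non-constant morphism $\varphi\colon\mathbb{P}^1\to X$ such that (i) the preimage of the big torus orbit is dense in $\mathbb{P}^1$ and $\varphi(\mathbb{P}^1)$ is disjoint from all toric strata of codimension greater than $1$; (ii) every toric prime divisor $D$ of $X$ satisfies $\sharp\,\varphi^{-1}(D)\le 1$; (iii) at most three toric prime divisors $D$ have $\varphi^{-1}(D)\neq\emptyset$. Let $u_1,u_2,u_3\in M$ be primitive and let $w_1,w_2,w_3$ be positive integers with $\sum_{i=1}^3 w_iu_i=0$. Let $\varphi\colon\mathbb{P}^1\to X$ be a line of type $((u_1,u_2,u_3),(w_1,w_2,w_3))$: the $u_i$ are pairwise distinct, they are exactly the primitive generators of the rays of $\Sigma$ whose toric divisors $D_i$ meet $\varphi(\mathbb{P}^1)$, and $w_i=\deg\varphi^*D_i$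 is the intersection number of $\varphi$ with $D_i$. Then every singular point of the image curve $\varphi(\mathbb{P}^1)$ (with its reduced structure) is a node, that is, an ordinary double point (locally analytically the curve is isomorphic to $\{ab=0\}\subset\mathbb{C}^2$ at the origin), and it lies in the big torus orbit of $X$. -/

import Mathlib

/-! ### Lattices, cones and fans

Throughout `M = ℤ ^ d` is written `Fin d → ℤ`, `M_ℝ = ℝ ^ d` is `Fin d → ℝ`, and the dual lattice
`N = Hom(M, ℤ)` is identified with `Fin d → ℤ` through the dot product. -/

namespace Toric

open scoped LinearAlgebra.Projectivization

variable {d : ℕ}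

/-- The inclusion of the lattice `M` in `M_ℝ`. -/
def latticeToReal (m : Fin d → ℤ) : Fin d → ℝ := fun i => (m i : ℝ)

/-- The pairing `N × M_ℝ → ℝ`. -/
def pairing (n : Fin d → ℤ) (v : Fin d → ℝ) : ℝ := ∑ i, (n i : ℝ) * v i

lemma pairing_zero_left (v : Fin d → ℝ) : pairing 0 v = 0 := by simp [pairing]

lemma pairing_add_left (a b : Fin d → ℤ) (v : Fin d → ℝ) :
    pairing (a + b) v = pairing a v + pairing b v := by
  simp [pairing, add_mul, Finset.sum_add_distrib]

lemma pairing_zero_right (n : Fin d → ℤ) : pairing n (0 : Fin d → ℝ) = 0 := by simp [pairing]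

lemma pairing_add_right (n : Fin d → ℤ) (v w : Fin d → ℝ) :
    pairing n (v + w) = pairing n v + pairing n w := by
  simp [pairing, mul_add, Finset.sum_add_distrib]

lemma pairing_smul_right (n : Fin d → ℤ) (c : ℝ) (v : Fin d → ℝ) :
    pairing n (c • v) = c * pairing n v := by
  simp only [pairing, Pi.smul_apply, smul_eq_mul, Finset.mul_sum]
  exact Finset.sum_congr rfl fun i _ => by ring

/-- The hyperplane `n^⊥` in `M_ℝ`, as a cone. -/
def hyperplane (n : Fin d → ℤ) : PointedCone ℝ (Fin d → ℝ) where
  carrier := {v | pairing n v = 0}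
  zero_mem' := pairing_zero_right n
  add_mem' {v w} hv hw := by
    have hv' : pairing n v = 0 := hv
    have hw' : pairing n w = 0 := hw
    show pairing n (v + w) = 0
    rw [pairing_add_right, hv', hw', add_zero]
  smul_mem' c v hv := by
    have hv' : pairing n v = 0 := hv
    show pairing n ((c : ℝ) • v) = 0
    rw [pairing_smul_right, hv', mul_zero]

/-- The semigroup `S_σ = σ^∨ ∩ N` of a cone `σ`. -/
def dualMonoid (σ : PointedCone ℝ (Fin d → ℝ)) : AddSubmonoid (Fin d → ℤ) where
  carrier := {n | ∀ v ∈ σ, 0 ≤ pairing n v}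
  zero_mem' v _ := (pairing_zero_left v).ge
  add_mem' {a b} ha hb v hv := by
    rw [pairing_add_left]
    exact add_nonneg (ha v hv) (hb v hv)

lemma dualMonoid_anti {σ τ : PointedCone ℝ (Fin d → ℝ)} (h : τ ≤ σ) :
    dualMonoid σ ≤ dualMonoid τ := fun _ hn v hv => hn v (h hv)

/-- `τ` is a face of the (rational polyhedral) cone `σ`: it is cut out by a supporting
hyperplane `n^⊥` with `n ∈ σ^∨ ∩ N`. -/
def IsFace (τ σ : PointedCone ℝ (Fin d → ℝ)) : Prop :=
  ∃ n ∈ dualMonoid σ, τ = σ ⊓ hyperplane n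

/-- A fan in `M_ℝ`: a finite collection of strongly convex rational polyhedral cones that contains
every face of each of its members, and in which any two members meet in a common face. -/
structure Fan (d : ℕ) where
  cones : Set (PointedCone ℝ (Fin d → ℝ))
  finite : cones.Finite
  rational : ∀ σ ∈ cones, ∃ S : Finset (Fin d → ℤ),
    σ = PointedCone.hull ℝ (latticeToReal '' (S : Set (Fin d → ℤ)))
  stronglyConvex : ∀ σ ∈ cones, ∀ v ∈ σ, -v ∈ σ → v = 0
  face_mem : ∀ σ ∈ cones, ∀ τ, IsFace τ σ → τ ∈ cones
  inter_isFace : ∀ σ ∈ cones, ∀ τ ∈ cones, IsFace (σ ⊓ τ) σ ∧ IsFace (σ ⊓ τ) τ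

/-- A fan is complete if its cones cover `M_ℝ`; this is completeness of the toric variety. -/
def Fan.IsComplete (Δ : Fan d) : Prop := ∀ v : Fin d → ℝ, ∃ σ ∈ Δ.cones, v ∈ σ

/-- The dimension of a cone. -/
noncomputable def coneDim (σ : PointedCone ℝ (Fin d → ℝ)) : ℕ :=
  Module.finrank ℝ (Submodule.span ℝ (σ : Set (Fin d → ℝ)))

/-- A lattice vector is primitive if it is not a proper multiple of a lattice vector
(in particular it is not zero). -/
def IsPrimitive (u : Fin d → ℤ) : Prop := ∀ (k : ℤ) (m : Fin d → ℤ), u = k • m → IsUnit k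

/-- The ray spanned by a lattice vector. -/
def ray (u : Fin d → ℤ) : PointedCone ℝ (Fin d → ℝ) := PointedCone.hull ℝ {latticeToReal u}

/-- `u` is the primitive generator of a ray of the fan. -/
def Fan.IsRayGenerator (Δ : Fan d) (u : Fin d → ℤ) : Prop := IsPrimitive u ∧ ray u ∈ Δ.cones

/-! ### The toric variety of a fan (its complex points) -/

/-- The complex points of the affine toric variety `U_σ = Spec ℂ[S_σ]`: the semigroup
homomorphisms `S_σ → (ℂ, ·)`. The value of such a homomorphism `x` at `n` is the value of the
monomial `z^n` at the point. -/
abbrev Affine (σ : PointedCone ℝ (Fin d → ℝ)) : Type :=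
  Multiplicative (dualMonoid σ) →* ℂ

/-- The value of the monomial `z^n` at a point of `U_σ`. -/
def Affine.monomial {σ : PointedCone ℝ (Fin d → ℝ)} (x : Affine σ) (n : dualMonoid σ) : ℂ :=
  x (Multiplicative.ofAdd n)

/-- For `τ ≤ σ`, the map `U_τ → U_σ` given by restriction of semigroup homomorphisms; it is an open
immersion when `τ` is a face of `σ`. -/
def Affine.extend {σ τ : PointedCone ℝ (Fin d → ℝ)} (h : τ ≤ σ) (x : Affine τ) : Affine σ :=
  x.comp (AddMonoidHom.toMultiplicative (AddSubmonoid.inclusion (dualMonoid_anti h)))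

/-- The gluing relation: `x ∈ U_σ` and `y ∈ U_τ` are identified if both come from the same point of
`U_{σ ∩ τ}`. -/
def Fan.GlueRel (Δ : Fan d) (p q : Σ σ : Δ.cones, Affine σ.1) : Prop :=
  ∃ z : Affine (p.1.1 ⊓ q.1.1),
    z.extend inf_le_left = p.2 ∧ z.extend inf_le_right = q.2

/-- The toric variety of a fan (as the set of its complex points), glued from the affine toric
varieties `U_σ`. -/
def Fan.Variety (Δ : Fan d) : Type := Quot Δ.GlueRel

/-- The chart `U_σ → X`. -/
def Fan.chart (Δ : Fan d) (σ : Δ.cones) (x : Affine σ.1) : Δ.Variety := Quot.mk _ ⟨σ, x⟩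

/-- The torus orbit of a cone `τ`: the points of `U_τ` at which `z^n`, `n ∈ S_τ`, is nonzero exactly
when `n ∈ τ^⊥`. It has codimension `dim τ`. -/
def Fan.orbit (Δ : Fan d) (τ : Δ.cones) : Set Δ.Variety :=
  {p | ∃ x : Affine τ.1, p = Δ.chart τ x ∧
    ∀ n : dualMonoid τ.1, x.monomial n ≠ 0 ↔ ∀ v ∈ τ.1, pairing n.1 v = 0}

/-- The big torus orbit: the orbit of the zero cone. -/
def Fan.bigTorus (Δ : Fan d) : Set Δ.Variety :=
  {p | ∃ τ : Δ.cones, τ.1 = ⊥ ∧ p ∈ Δ.orbit τ}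

/-- The toric prime divisor of the ray generated by `u`: the closure of the orbit of the ray, that
is the union of the orbits of all cones that contain the ray. -/
def Fan.divisor (Δ : Fan d) (u : Fin d → ℤ) : Set Δ.Variety :=
  {p | ∃ τ : Δ.cones, ray u ≤ τ.1 ∧ p ∈ Δ.orbit τ}

/-! ### Maps from the projective line -/

/-- The complex projective line. -/
abbrev P1 : Type := ℙ ℂ (Fin 2 → ℂ)

/-- The value of a binary form at the chosen representative of a point of the projective line. Only
vanishing of such values, and quotients of values of forms of equal degree, are used. -/
noncomputable def formEval (F : MvPolynomial (Fin 2) ℂ) (p : P1) : ℂ := MvPolynomial.eval p.rep F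

/-- The linear form, unique up to a scalar, that vanishes exactly at the point `q`. -/
noncomputable def linearForm (q : P1) : MvPolynomial (Fin 2) ℂ :=
  MvPolynomial.C (q.rep 1) * MvPolynomial.X 0 - MvPolynomial.C (q.rep 0) * MvPolynomial.X 1

/-- `f` is a regular function on the Zariski open subset `W` of the projective line: near each point
of `W` it is a quotient of two forms of the same degree. -/
def RegularOn (W : Set P1) (f : P1 → ℂ) : Prop :=
  ∀ q ∈ W, ∃ (e : ℕ) (F G : MvPolynomial (Fin 2) ℂ), F.IsHomogeneous e ∧ G.IsHomogeneous e ∧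
    formEval G q ≠ 0 ∧ ∀ p ∈ W, formEval G p ≠ 0 → f p = formEval F p / formEval G p

/-- The function `f`, regular on the Zariski neighbourhood `W` of `q`, has order of vanishing `k`
at `q`: it is `ℓ ^ k * F / G` with `ℓ` the linear form of `q` and `F`, `G` nonzero at `q`. -/
def HasOrderAt (W : Set P1) (f : P1 → ℂ) (q : P1) (k : ℕ) : Prop :=
  ∃ (e : ℕ) (F G : MvPolynomial (Fin 2) ℂ), F.IsHomogeneous e ∧ G.IsHomogeneous (e + k) ∧
    formEval F q ≠ 0 ∧ formEval G q ≠ 0 ∧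
    ∀ p ∈ W, formEval G p ≠ 0 → f p = formEval (linearForm q ^ k * F) p / formEval G p

/-- `φ` is a morphism of algebraic varieties: each point has a Zariski open (that is, cofinite)
neighbourhood `W` that `φ` maps into a chart `U_σ`, with all monomials `z^n`, `n ∈ S_σ`, pulled back
to regular functions on `W`. -/
def IsMorphism (Δ : Fan d) (φ : P1 → Δ.Variety) : Prop :=
  ∀ q : P1, ∃ (σ : Δ.cones) (W : Set P1) (x : P1 → Affine σ.1), q ∈ W ∧ Wᶜ.Finite ∧
    (∀ p ∈ W, φ p = Δ.chart σ (x p)) ∧ ∀ n, RegularOn W (fun p => (x p).monomial n)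

/-- The map is torically transverse: the preimage of the big torus orbit is Zariski dense in the
projective line (that is, infinite), and the image is disjoint from all toric strata of codimension
greater than one. -/
def IsToricallyTransverse (Δ : Fan d) (φ : P1 → Δ.Variety) : Prop :=
  (φ ⁻¹' Δ.bigTorus).Infinite ∧ ∀ τ : Δ.cones, 1 < coneDim τ.1 → ∀ q, φ q ∉ Δ.orbit τ

/-- A line in a toric variety: a non-constant torically transverse morphism from the projective
line, such that each toric prime divisor has at most one preimage point, and at most three toric
prime divisors are met. -/
structure IsLine (Δ : Fan d) (φ : P1 → Δ.Variety) : Prop where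
  morphism : IsMorphism Δ φ
  nonconstant : ∃ p q, φ p ≠ φ q
  transverse : IsToricallyTransverse Δ φ
  subsingleton : ∀ u, Δ.IsRayGenerator u → (φ ⁻¹' Δ.divisor u).Subsingleton
  atMostThree : {u | Δ.IsRayGenerator u ∧ (φ ⁻¹' Δ.divisor u).Nonempty}.encard ≤ 3

/-- The local intersection multiplicity at `q` of `φ` with the toric prime divisor of the ray
generated by `u` is `k`, where `φ q` lies in the orbit of the ray: `φ` maps a Zariski neighbourhood
`W` of `q` to the chart of the ray, and the pullback of the equation `z^n`, `⟨n, u⟩ = 1`, of the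
divisor in that chart has order of vanishing `k` at `q`. -/
def HasLocalMultiplicity (Δ : Fan d) (φ : P1 → Δ.Variety) (u : Fin d → ℤ) (q : P1) (k : ℕ) : Prop :=
  ∃ (hu : ray u ∈ Δ.cones) (W : Set P1) (x : P1 → Affine (ray u)) (n : dualMonoid (ray u)),
    q ∈ W ∧ Wᶜ.Finite ∧ (∀ p ∈ W, φ p = Δ.chart ⟨ray u, hu⟩ (x p)) ∧
    (∀ m, RegularOn W (fun p => (x p).monomial m)) ∧
    ∑ i, n.1 i * u i = 1 ∧ HasOrderAt W (fun p => (x p).monomial n) q k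

/-- A line `φ` has type `(u, w)` if the `u i` are, without repetition, the primitive generators of
the rays whose divisors are met by `φ`, and `w i` is the intersection number of `φ` with the divisor
of `u i`. As `φ` is a line, the divisor of `u i` has exactly one preimage point, and the intersection
number is the local multiplicity there. -/
def HasType {a : ℕ} (Δ : Fan d) (φ : P1 → Δ.Variety) (u : Fin a → Fin d → ℤ) (w : Fin a → ℕ) :
    Prop :=
  Function.Injective u ∧
  Set.range u = {v | Δ.IsRayGenerator v ∧ (φ ⁻¹' Δ.divisor v).Nonempty} ∧
  ∀ i, ∀ q ∈ φ ⁻¹' Δ.divisor (u i), HasLocalMultiplicity Δ φ (u i) q (w i)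

/-! ### Singularities of curves -/

/-- The germ at `y` of the (reduced) complex analytic subset `Y` of `E` is isomorphic to the germ at
`z` of the complex analytic subset `Z` of `F`: ambient holomorphic maps near `y` and `z` restrict to
mutually inverse bijections. -/
def GermIso {E F : Type*} [NormedAddCommGroup E] [NormedSpace ℂ E] [NormedAddCommGroup F]
    [NormedSpace ℂ F] (Y : Set E) (y : E) (Z : Set F) (z : F) : Prop :=
  y ∈ Y ∧ z ∈ Z ∧ ∃ (U : Set E) (V : Set F) (f : E → F) (g : F → E),
    IsOpen U ∧ IsOpen V ∧ y ∈ U ∧ z ∈ V ∧ AnalyticOnNhd ℂ f U ∧ AnalyticOnNhd ℂ g V ∧ f y = z ∧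
    Set.MapsTo f (Y ∩ U) (Z ∩ V) ∧ Set.MapsTo g (Z ∩ V) (Y ∩ U) ∧
    (∀ a ∈ Y ∩ U, g (f a) = a) ∧ ∀ b ∈ Z ∩ V, f (g b) = b

/-- The germ at `p` of the curve `C`, with its reduced structure, in a toric variety is isomorphic to
the germ of `Z` at `z`. The germ of `C` is taken in a chart `U_σ` around `p`, embedded in an affine
space by the monomials of a finite set of generators of `S_σ`; up to isomorphism it does not depend
on these choices. -/
def HasGerm {F : Type*} [NormedAddCommGroup F] [NormedSpace ℂ F] (Δ : Fan d) (C : Set Δ.Variety)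
    (p : Δ.Variety) (Z : Set F) (z : F) : Prop :=
  ∃ (σ : Δ.cones) (x : Affine σ.1) (k : ℕ) (g : Fin k → dualMonoid σ.1),
    Δ.chart σ x = p ∧ AddSubmonoid.closure (Set.range g) = ⊤ ∧
    GermIso ((fun (y : Affine σ.1) (i : Fin k) => y.monomial (g i)) '' {y | Δ.chart σ y ∈ C})
      (fun i => x.monomial (g i)) Z z

/-- The curve `C` is smooth at `p`: its germ is isomorphic to the germ of the complex line. -/
def IsSmoothPoint (Δ : Fan d) (C : Set Δ.Variety) (p : Δ.Variety) : Prop :=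
  HasGerm Δ C p (Set.univ : Set ℂ) 0

/-- `p` is a singular point of the curve `C`. -/
def IsSingularPoint (Δ : Fan d) (C : Set Δ.Variety) (p : Δ.Variety) : Prop :=
  p ∈ C ∧ ¬ IsSmoothPoint Δ C p

/-- `p` is a node (ordinary double point) of the curve `C`: the germ of `C` at `p` is isomorphic to
the germ at the origin of `a * b = 0` in the complex plane. -/
def IsNode (Δ : Fan d) (C : Set Δ.Variety) (p : Δ.Variety) : Prop :=
  HasGerm Δ C p {c : ℂ × ℂ | c.1 * c.2 = 0} 0

end Toric

/-!
A line of type `(u, w)` meets the divisors of `u 0`, `u 1`, `u 2` in one point each, and these points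
are distinct because the Laurent monomials that are regular at a point of the divisor of `u i` form
exactly the half-plane of `u i`. In the coordinate `t` that puts the three points at `0`, `1`, `∞`,
the pullback of a Laurent monomial `z^n` is a rational function with order `w i * ⟨n, u i⟩` at the
`i`-th point and no other zeros or poles, so by Liouville's theorem it is a constant multiple of
`t ^ (w 0 * ⟨n, u 0⟩) * (t - 1) ^ (w 1 * ⟨n, u 1⟩)` (`Toric.HasType.exists_isNormalForm`). In other
words `φ` is, up to a translation of the torus, the line `x - y = 1` followed by the monomial map of
exponents `w i * ⟨n, u i⟩`, an isogeny of tori since `u 0` and `u 1` are independent.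

An isogeny is étale with finite kernel, so `φ` is an immersion over the torus, and two parameters
`s`, `t` with the same image satisfy `|s| = |t|` and `|s - 1| = |t - 1|`. Two circles with centres
`0` and `1` meet in at most a pair of conjugate points, so fibres have at most two points. The tangent
vectors at `t₀` and `t₁` are, in logarithmic coordinates, the images of `(1 / t₀, 1 / (t₀ - 1))` and
`(1 / t₁, 1 / (t₁ - 1))`, which are independent when `t₀ ≠ t₁`
(`Toric.germIso_monomialCurve`). A single immersed branch is smooth, and two transversal branches
`γ (t₀ + x)`, `γ (t₁ + y)` through `p` form a node: the map `(x, y) ↦ γ (t₀ + x) + γ (t₁ + y) - p`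
carries the two axes to the two branches (`Toric.germIso_univ_of_fiber_subsingleton`,
`Toric.germIso_node_of_fiber_pair`). Both use that the curve is closed near `p`, which holds as the
monomials that pull back to powers of `t` and of `t - 1` keep the parameter in a compact set.

At the point on the divisor of `u 0`, the monomial generating `(u 0)^⊥` pulls back to a power of
`t - 1`, which is a local coordinate at `t = 0`, and that point is the only one on the divisor; so the
curve is smooth there (`Toric.HasType.isSmoothPoint_of_mem_divisor`). All singular points are
therefore nodes in the big torus.

To compute with points of the glued variety, the values at a point of all Laurent monomials regular
there are recorded (`Toric.Fan.laurent`). This does not depend on the chart because passing from a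
cone to a face localizes the dual monoid (`Toric.exists_add_nsmul_mem_dualMonoid`).
-/

namespace Toric

open Filter Topology

/-! ### Dual monoids of faces -/

section Monoid

variable {d : ℕ} {σ τ : PointedCone ℝ (Fin d → ℝ)}

lemma pairing_latticeToReal (n m : Fin d → ℤ) :
    pairing n (latticeToReal m) = ((∑ i, n i * m i : ℤ) : ℝ) := by
  simp [pairing, latticeToReal]

lemma pairing_neg_left (n : Fin d → ℤ) (v : Fin d → ℝ) : pairing (-n) v = -pairing n v := by
  simp [pairing]

lemma pairing_nsmul_left (k : ℕ) (n : Fin d → ℤ) (v : Fin d → ℝ) :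
    pairing (k • n) v = k * pairing n v := by
  simp [pairing, Finset.mul_sum, mul_assoc]

lemma mem_dualMonoid_hull {s : Set (Fin d → ℝ)} {n : Fin d → ℤ} :
    n ∈ dualMonoid (PointedCone.hull ℝ s) ↔ ∀ v ∈ s, 0 ≤ pairing n v := by
  refine ⟨fun h v hv => h v (PointedCone.subset_hull hv), fun h v hv => ?_⟩
  induction hv using Submodule.span_induction with
  | mem x hx => exact h x hx
  | zero => exact (pairing_zero_right n).ge
  | add x y _ _ hx hy => rw [pairing_add_right]; exact add_nonneg hx hy
  | smul a x _ hx =>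
    have : pairing n (a • x) = (a : ℝ) * pairing n x := pairing_smul_right n a x
    rw [this]; exact mul_nonneg a.2 hx

lemma mem_dualMonoid_of_eq_hull {S : Finset (Fin d → ℤ)}
    (hS : σ = PointedCone.hull ℝ (latticeToReal '' (S : Set (Fin d → ℤ)))) {n : Fin d → ℤ} :
    n ∈ dualMonoid σ ↔ ∀ s ∈ S, 0 ≤ pairing n (latticeToReal s) := by
  subst hS
  simp [mem_dualMonoid_hull]

lemma mem_dualMonoid_ray {u n : Fin d → ℤ} : n ∈ dualMonoid (ray u) ↔ 0 ≤ ∑ i, n i * u i := by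
  rw [ray, mem_dualMonoid_hull]
  simp only [Set.mem_singleton_iff, forall_eq, pairing_latticeToReal]
  exact Int.cast_nonneg_iff

lemma mem_face {n : Fin d → ℤ} {v : Fin d → ℝ} :
    v ∈ σ ⊓ hyperplane n ↔ v ∈ σ ∧ pairing n v = 0 := Iff.rfl

/-- Localization: if the face `τ` of a rational polyhedral cone `σ` is cut out by `n ∈ S_σ`, then
`S_τ = S_σ - ℕ n`. -/
lemma exists_add_nsmul_mem_dualMonoid
    (hσ : ∃ S : Finset (Fin d → ℤ),
      σ = PointedCone.hull ℝ (latticeToReal '' (S : Set (Fin d → ℤ))))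
    {n m : Fin d → ℤ} (hn : n ∈ dualMonoid σ) (hm : m ∈ dualMonoid (σ ⊓ hyperplane n)) :
    ∃ k : ℕ, m + k • n ∈ dualMonoid σ := by
  obtain ⟨S, rfl⟩ := hσ
  have key : ∀ s ∈ S, ∀ᶠ k : ℕ in atTop, 0 ≤ pairing (m + k • n) (latticeToReal s) := by
    intro s hs
    have hs' : latticeToReal s ∈
        PointedCone.hull ℝ (latticeToReal '' (S : Set (Fin d → ℤ))) :=
      PointedCone.subset_hull ⟨s, hs, rfl⟩
    have h0 := hn _ hs'
    simp only [pairing_add_left, pairing_nsmul_left]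
    rcases h0.eq_or_lt with h0 | h0
    · have := hm _ (mem_face.2 ⟨hs', h0.symm⟩)
      exact Eventually.of_forall fun k => by rw [← h0]; simpa using this
    · have : Tendsto (fun k : ℕ => pairing m (latticeToReal s)
          + (k : ℝ) * pairing n (latticeToReal s)) atTop atTop :=
        tendsto_atTop_add_const_left _ _
          (tendsto_natCast_atTop_atTop.atTop_mul_const h0)
      exact this.eventually_ge_atTop 0
  obtain ⟨k, hk⟩ := ((eventually_all_finset S).2 key).exists
  exact ⟨k, (mem_dualMonoid_of_eq_hull rfl).2 hk⟩

lemma neg_mem_dualMonoid_face (n : Fin d → ℤ) : -n ∈ dualMonoid (σ ⊓ hyperplane n) := by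
  intro v hv
  rw [pairing_neg_left, (mem_face.1 hv).2, neg_zero]

end Monoid

/-! ### Laurent monomials on the toric variety -/

section Laurent

variable {d : ℕ} {σ τ : PointedCone ℝ (Fin d → ℝ)}

lemma Affine.monomial_add (x : Affine σ) (a b : dualMonoid σ) :
    x.monomial (a + b) = x.monomial a * x.monomial b := map_mul x _ _

lemma Affine.monomial_zero (x : Affine σ) : x.monomial 0 = 1 := map_one x

lemma Affine.monomial_nsmul (x : Affine σ) (k : ℕ) (a : dualMonoid σ) :
    x.monomial (k • a) = x.monomial a ^ k := map_pow x (Multiplicative.ofAdd a) k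

lemma Affine.monomial_extend (h : τ ≤ σ) (x : Affine τ) (a : dualMonoid σ) :
    (x.extend h).monomial a = x.monomial ⟨a, dualMonoid_anti h a.2⟩ := rfl

lemma Affine.ext_monomial {x y : Affine σ} (h : ∀ a, x.monomial a = y.monomial a) : x = y :=
  MonoidHom.ext fun a => h (Multiplicative.toAdd a)

lemma Affine.monomial_ne_zero_of_neg_mem (x : Affine σ) {n : Fin d → ℤ} (hn : n ∈ dualMonoid σ)
    (hn' : -n ∈ dualMonoid σ) : x.monomial ⟨n, hn⟩ ≠ 0 := by
  intro h
  have := x.monomial_add ⟨n, hn⟩ ⟨-n, hn'⟩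
  rw [h, zero_mul] at this
  have h0 : (⟨n, hn⟩ + ⟨-n, hn'⟩ : dualMonoid σ) = 0 := Subtype.ext (add_neg_cancel n)
  rw [h0, x.monomial_zero] at this
  exact one_ne_zero this

/-- The graph of the evaluation of Laurent monomials at a point `x` of `U_σ`, on those monomials
that are regular at `x`: the pairs `(a - b, z^a(x) / z^b(x))` with `z^b(x) ≠ 0`. -/
def Affine.laurentGraph (x : Affine σ) : Set ((Fin d → ℤ) × ℂ) :=
  {r | ∃ a b : dualMonoid σ, x.monomial b ≠ 0 ∧ r.1 = a.1 - b.1 ∧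
    r.2 = x.monomial a / x.monomial b}

lemma Affine.laurentGraph_unique (x : Affine σ) {n : Fin d → ℤ} {c c' : ℂ}
    (h : (n, c) ∈ x.laurentGraph) (h' : (n, c') ∈ x.laurentGraph) : c = c' := by
  obtain ⟨a, b, hb, hn, hc⟩ := h
  obtain ⟨a', b', hb', hn', hc'⟩ := h'
  simp only at hn hc hn' hc'
  have e : a + b' = a' + b := Subtype.ext <| by
    show a.1 + b'.1 = a'.1 + b.1
    have := hn.symm.trans hn'
    linear_combination this
  have e' := congrArg x.monomial e
  rw [x.monomial_add, x.monomial_add] at e'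
  rw [hc, hc', div_eq_div_iff hb hb', e']

lemma Affine.mem_laurentGraph (x : Affine σ) (a : dualMonoid σ) :
    (a.1, x.monomial a) ∈ x.laurentGraph :=
  ⟨a, 0, by simp [x.monomial_zero], by simp, by simp [x.monomial_zero]⟩

/-- Passing to the smaller chart of a face does not change which Laurent monomials are regular at
a point, nor their values. -/
lemma Affine.laurentGraph_extend
    (hσ : ∃ S : Finset (Fin d → ℤ),
      σ = PointedCone.hull ℝ (latticeToReal '' (S : Set (Fin d → ℤ))))
    (hf : IsFace τ σ) (h : τ ≤ σ) (x : Affine τ) :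
    (x.extend h).laurentGraph = x.laurentGraph := by
  obtain ⟨n, hn, rfl⟩ := hf
  ext ⟨m, c⟩
  constructor
  · rintro ⟨a, b, hb, hm, hc⟩
    exact ⟨_, _, hb, hm, hc⟩
  · rintro ⟨a, b, hb, hm, hc⟩
    obtain ⟨k, hk⟩ := exists_add_nsmul_mem_dualMonoid hσ hn a.2
    obtain ⟨l, hl⟩ := exists_add_nsmul_mem_dualMonoid hσ hn b.2
    have hnk : x.monomial ⟨n, dualMonoid_anti h hn⟩ ≠ 0 :=
      x.monomial_ne_zero_of_neg_mem _ (neg_mem_dualMonoid_face n)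
    have hv : ∀ (a : dualMonoid (σ ⊓ hyperplane n)) (k l : ℕ)
        (hk : a.1 + k • n + l • n ∈ dualMonoid σ),
        (x.extend h).monomial ⟨_, hk⟩ =
          x.monomial a * x.monomial ⟨n, dualMonoid_anti h hn⟩ ^ (k + l) := by
      intro a k l hk
      rw [← x.monomial_nsmul, ← x.monomial_add, Affine.monomial_extend]
      congr 1
      refine Subtype.ext ?_
      show a.1 + k • n + l • n = a.1 + (k + l) • n
      rw [add_smul, add_assoc]
    have hkl : a.1 + k • n + l • n ∈ dualMonoid σ := add_mem hk (nsmul_mem hn l)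
    have hlk : b.1 + l • n + k • n ∈ dualMonoid σ := add_mem hl (nsmul_mem hn k)
    refine ⟨⟨_, hkl⟩, ⟨_, hlk⟩, ?_, ?_, ?_⟩
    · rw [hv]
      exact mul_ne_zero hb (pow_ne_zero _ hnk)
    · simp only at hm ⊢
      rw [hm]; abel
    · rw [hv, hv, add_comm l k, mul_div_mul_right _ _ (pow_ne_zero _ hnk)]
      exact hc

variable {Δ : Fan d}

/-- The pairs of a Laurent monomial that is regular at the point `P` of the toric variety, and its
value there. -/
def Fan.laurentGraph (Δ : Fan d) (P : Δ.Variety) : Set ((Fin d → ℤ) × ℂ) :=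
  Quot.lift (fun p : Σ σ : Δ.cones, Affine σ.1 => p.2.laurentGraph) (by
    rintro ⟨σ, x⟩ ⟨τ, y⟩ ⟨z, hx, hy⟩
    simp only at hx hy ⊢
    rw [← hx, ← hy, Affine.laurentGraph_extend (Δ.rational _ σ.2)
        (Δ.inter_isFace _ σ.2 _ τ.2).1, Affine.laurentGraph_extend (Δ.rational _ τ.2)
        (Δ.inter_isFace _ σ.2 _ τ.2).2]) P

open Classical in
/-- The value at `P` of the Laurent monomial `z^n`, with junk value `0` if `z^n` is not regular
at `P`. -/
noncomputable def Fan.laurent (Δ : Fan d) (P : Δ.Variety) (n : Fin d → ℤ) : ℂ :=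
  if h : ∃ c, (n, c) ∈ Δ.laurentGraph P then h.choose else 0

lemma Fan.laurent_eq {σ : Δ.cones} {x : Affine σ.1} {n : Fin d → ℤ} {c : ℂ}
    (h : (n, c) ∈ x.laurentGraph) : Δ.laurent (Δ.chart σ x) n = c := by
  have h' : ∃ c, (n, c) ∈ Δ.laurentGraph (Δ.chart σ x) := ⟨c, h⟩
  rw [Fan.laurent, dif_pos h']
  exact x.laurentGraph_unique h'.choose_spec h

lemma Fan.laurent_chart (σ : Δ.cones) (x : Affine σ.1) (a : dualMonoid σ.1) :
    Δ.laurent (Δ.chart σ x) a = x.monomial a := Fan.laurent_eq (x.mem_laurentGraph a)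

lemma Fan.laurent_chart_sub (σ : Δ.cones) (x : Affine σ.1) (a b : dualMonoid σ.1)
    (hb : x.monomial b ≠ 0) :
    Δ.laurent (Δ.chart σ x) (a.1 - b.1) = x.monomial a / x.monomial b :=
  Fan.laurent_eq ⟨a, b, hb, rfl, rfl⟩

/-- The Laurent monomials that are regular at a point. -/
def Fan.regularAt (Δ : Fan d) (P : Δ.Variety) : Set (Fin d → ℤ) :=
  {n | ∃ c, (n, c) ∈ Δ.laurentGraph P}

lemma Fan.mem_regularAt (σ : Δ.cones) (x : Affine σ.1) (n : dualMonoid σ.1) :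
    n.1 ∈ Δ.regularAt (Δ.chart σ x) := ⟨_, x.mem_laurentGraph n⟩

lemma Fan.exists_of_mem_regularAt {σ : Δ.cones} {x : Affine σ.1} {n : Fin d → ℤ}
    (h : n ∈ Δ.regularAt (Δ.chart σ x)) :
    ∃ a b : dualMonoid σ.1, x.monomial b ≠ 0 ∧ n = a.1 - b.1 := by
  obtain ⟨c, a, b, hb, hn, -⟩ := h
  exact ⟨a, b, hb, hn⟩

lemma Fan.chart_extend {σ τ : Δ.cones} (h : τ.1 ≤ σ.1) (x : Affine τ.1) :
    Δ.chart σ (x.extend h) = Δ.chart τ x := by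
  refine (Quot.sound ?_).symm
  have h' : τ.1 ≤ τ.1 ⊓ σ.1 := le_inf le_rfl h
  exact ⟨x.extend h', Affine.ext_monomial fun a => rfl, Affine.ext_monomial fun a => rfl⟩

end Laurent

/-! ### The decomposition into torus orbits -/

section Orbits

variable {d : ℕ} {Δ : Fan d}

/-- A point `x` of `U_σ` extends over the localization by an element at which it does not
vanish. -/
lemma Affine.exists_extend_eq {σ : PointedCone ℝ (Fin d → ℝ)}
    (hσ : ∃ S : Finset (Fin d → ℤ),
      σ = PointedCone.hull ℝ (latticeToReal '' (S : Set (Fin d → ℤ))))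
    (x : Affine σ) (n : dualMonoid σ) (hn : x.monomial n ≠ 0) :
    ∃ z : Affine (σ ⊓ hyperplane n.1), z.extend inf_le_left = x := by
  have H : ∀ m : dualMonoid (σ ⊓ hyperplane n.1), ∃ k : ℕ, m.1 + k • n.1 ∈ dualMonoid σ :=
    fun m => exists_add_nsmul_mem_dualMonoid hσ n.2 m.2
  choose k hk using H
  have val : ∀ (m : dualMonoid (σ ⊓ hyperplane n.1)) (a : dualMonoid σ) (l : ℕ),
      a.1 = m.1 + l • n.1 →
      x.monomial ⟨_, hk m⟩ / x.monomial n ^ k m = x.monomial a / x.monomial n ^ l := by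
    intro m a l ha
    rw [div_eq_div_iff (pow_ne_zero _ hn) (pow_ne_zero _ hn), ← x.monomial_nsmul,
      ← x.monomial_nsmul, ← x.monomial_add, ← x.monomial_add]
    congr 1
    refine Subtype.ext ?_
    show m.1 + k m • n.1 + l • n.1 = a.1 + k m • n.1
    rw [ha]; abel
  refine ⟨{ toFun := fun m => x.monomial ⟨_, hk m.toAdd⟩ / x.monomial n ^ k m.toAdd
            map_one' := ?_
            map_mul' := ?_ }, ?_⟩
  · rw [val _ 0 0 (by simp)]
    simp [x.monomial_zero]
  · intro m m'
    rw [val (m * m').toAdd (⟨_, hk m.toAdd⟩ + ⟨_, hk m'.toAdd⟩) (k m.toAdd + k m'.toAdd) ?_,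
      x.monomial_add, pow_add, mul_div_mul_comm]
    show (m.toAdd.1 + k m.toAdd • n.1) + (m'.toAdd.1 + k m'.toAdd • n.1) =
      m.toAdd.1 + m'.toAdd.1 + _
    rw [add_smul]; abel
  · refine Affine.ext_monomial fun a => ?_
    rw [Affine.monomial_extend]
    refine (val _ a 0 (by simp)).trans ?_
    simp

/-- Every point of the toric variety lies in the orbit of some cone of the fan: for `x` in `U_σ`, of
the face of `σ` on which all monomials that do not vanish at `x` are zero. -/
lemma Fan.exists_mem_orbit (P : Δ.Variety) : ∃ τ : Δ.cones, P ∈ Δ.orbit τ := by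
  obtain ⟨⟨σ, x⟩, rfl⟩ := Quot.exists_rep P
  have hσ := Δ.rational _ σ.2
  obtain ⟨S, hS⟩ := hσ
  classical
  -- For each generator of `σ` pick a monomial that does not vanish at `x`, positive on the
  -- generator if there is such a one; the sum `n` of these cuts out the face whose orbit holds `x`.
  have H : ∀ s : Fin d → ℤ, ∃ n : dualMonoid σ.1, x.monomial n ≠ 0 ∧
      ((∃ n' : dualMonoid σ.1, x.monomial n' ≠ 0 ∧ 0 < pairing n'.1 (latticeToReal s)) →
        0 < pairing n.1 (latticeToReal s)) := by
    intro s
    by_cases h : ∃ n' : dualMonoid σ.1, x.monomial n' ≠ 0 ∧ 0 < pairing n'.1 (latticeToReal s)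
    · obtain ⟨n', h1, h2⟩ := h
      exact ⟨n', h1, fun _ => h2⟩
    · exact ⟨0, by simp [x.monomial_zero], fun h' => absurd h' h⟩
  choose f hf0 hf using H
  set n : dualMonoid σ.1 := ∑ s ∈ S, f s with hn
  have hmem : ∀ s ∈ S, latticeToReal s ∈ σ.1 := fun s hs => by
    rw [hS]; exact PointedCone.subset_hull ⟨s, hs, rfl⟩
  have hxn : x.monomial n ≠ 0 := by
    have : x.monomial n = ∏ s ∈ S, x.monomial (f s) := by
      rw [hn]
      exact map_prod x (fun s => Multiplicative.ofAdd (f s)) S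
    rw [this]
    exact Finset.prod_ne_zero_iff.2 fun s _ => hf0 s
  have hpn : ∀ v, pairing n.1 v = ∑ s ∈ S, pairing (f s).1 v := by
    intro v
    let p : (Fin d → ℤ) →+ ℝ := ⟨⟨fun n => pairing n v, pairing_zero_left v⟩,
      fun a b => pairing_add_left a b v⟩
    have : n.1 = ∑ s ∈ S, (f s).1 := by rw [hn]; exact map_sum (dualMonoid σ.1).subtype f S
    rw [this]
    exact map_sum p _ S
  have hpos : ∀ n' : dualMonoid σ.1, x.monomial n' ≠ 0 → ∀ s ∈ S,
      pairing n.1 (latticeToReal s) = 0 → pairing n'.1 (latticeToReal s) = 0 := by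
    intro n' hn' s hs h0
    by_contra hne
    have h1 := hf s ⟨n', hn', lt_of_le_of_ne (n'.2 _ (hmem s hs)) (Ne.symm hne)⟩
    rw [hpn] at h0
    have := (Finset.sum_eq_zero_iff_of_nonneg
      (fun t _ => (f t).2 _ (hmem s hs))).1 h0 s hs
    exact h1.ne' this
  -- A monomial that does not vanish at `x` vanishes on the face.
  have hface : ∀ n' : dualMonoid σ.1, x.monomial n' ≠ 0 → ∀ v ∈ σ.1 ⊓ hyperplane n.1,
      pairing n'.1 v = 0 := by
    intro n' hn' v hv
    have h2 : -n'.1 ∈ dualMonoid (σ.1 ⊓ hyperplane n.1) := by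
      obtain ⟨k, hk⟩ : ∃ k : ℕ, -n'.1 + k • n.1 ∈ dualMonoid σ.1 := by
        have key : ∀ s ∈ S, ∀ᶠ k : ℕ in atTop,
            0 ≤ pairing (-n'.1 + k • n.1) (latticeToReal s) := by
          intro s hs
          simp only [pairing_add_left, pairing_nsmul_left, pairing_neg_left]
          rcases (n.2 _ (hmem s hs)).eq_or_lt with h0 | h0
          · have := hpos n' hn' s hs h0.symm
            exact Eventually.of_forall fun k => by rw [← h0, this]; simp
          · have : Tendsto (fun k : ℕ => -pairing n'.1 (latticeToReal s)
                + (k : ℝ) * pairing n.1 (latticeToReal s)) atTop atTop :=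
              tendsto_atTop_add_const_left _ _
                (tendsto_natCast_atTop_atTop.atTop_mul_const h0)
            exact this.eventually_ge_atTop 0
        obtain ⟨k, hk⟩ := ((eventually_all_finset S).2 key).exists
        exact ⟨k, (mem_dualMonoid_of_eq_hull hS).2 hk⟩
      intro v hv
      have := hk v hv.1
      rwa [pairing_add_left, pairing_nsmul_left, (mem_face.1 hv).2, mul_zero, add_zero] at this
    have h3 := h2 v hv
    rw [pairing_neg_left] at h3
    exact le_antisymm (by linarith) (n'.2 v hv.1)
  have hτmem : σ.1 ⊓ hyperplane n.1 ∈ Δ.cones := Δ.face_mem _ σ.2 _ ⟨n.1, n.2, rfl⟩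
  obtain ⟨z, hz⟩ := Affine.exists_extend_eq ⟨S, hS⟩ x n hxn
  refine ⟨⟨_, hτmem⟩, z, ?_, ?_⟩
  · show Δ.chart σ x = _
    rw [← hz, Fan.chart_extend (σ := σ) (τ := ⟨_, hτmem⟩)]
  intro m
  constructor
  · intro hm v hv
    obtain ⟨k, hk⟩ := exists_add_nsmul_mem_dualMonoid ⟨S, hS⟩ n.2 m.2
    have hzn : z.monomial ⟨n.1, dualMonoid_anti inf_le_left n.2⟩ ≠ 0 := by
      rw [← Affine.monomial_extend inf_le_left z n, hz]; exact hxn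
    have : x.monomial ⟨_, hk⟩ ≠ 0 := by
      rw [← hz, Affine.monomial_extend]
      have e : (⟨m.1 + k • n.1, dualMonoid_anti inf_le_left hk⟩ :
          dualMonoid (σ.1 ⊓ hyperplane n.1)) =
          m + k • ⟨n.1, dualMonoid_anti inf_le_left n.2⟩ := rfl
      rw [e, z.monomial_add, z.monomial_nsmul]
      exact mul_ne_zero hm (pow_ne_zero _ hzn)
    have h := hface _ this v hv
    rwa [pairing_add_left, pairing_nsmul_left, (mem_face.1 hv).2, mul_zero, add_zero] at h
  · intro hm
    refine z.monomial_ne_zero_of_neg_mem m.2 fun v hv => ?_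
    rw [pairing_neg_left, hm v hv, neg_zero]

end Orbits

/-! ### Primitive vectors and rays in the plane -/

section Primitive

/-- The quarter turn of a plane lattice vector `u`; for primitive `u` it generates `u^⊥`. -/
def quarterTurn (u : Fin 2 → ℤ) : Fin 2 → ℤ := ![-u 1, u 0]

lemma isPrimitive_iff_isCoprime {u : Fin 2 → ℤ} : IsPrimitive u ↔ IsCoprime (u 0) (u 1) := by
  constructor
  · intro h
    rw [Int.isCoprime_iff_gcd_eq_one]
    have := h (Int.gcd (u 0) (u 1)) ![u 0 / Int.gcd (u 0) (u 1), u 1 / Int.gcd (u 0) (u 1)] (by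
      funext i
      fin_cases i
      · exact (Int.mul_ediv_cancel' (Int.gcd_dvd_left _ _)).symm
      · exact (Int.mul_ediv_cancel' (Int.gcd_dvd_right _ _)).symm)
    simpa using Int.isUnit_iff_natAbs_eq.1 this
  · rintro ⟨r, s, h⟩ k m rfl
    refine IsUnit.of_mul_eq_one (r * m 0 + s * m 1) ?_
    simp only [Pi.smul_apply, smul_eq_mul] at h
    linear_combination h

lemma IsPrimitive.ne_zero {u : Fin 2 → ℤ} (h : IsPrimitive u) : u ≠ 0 := by
  rintro rfl
  exact not_isUnit_zero (h 0 0 (by simp))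

lemma exists_pairing_eq_one {u : Fin 2 → ℤ} (h : IsPrimitive u) :
    ∃ n : Fin 2 → ℤ, ∑ i, n i * u i = 1 := by
  obtain ⟨r, s, h⟩ := isPrimitive_iff_isCoprime.1 h
  exact ⟨![r, s], by simpa using h⟩

lemma exists_isPrimitive {s : Fin 2 → ℤ} (hs : s ≠ 0) :
    ∃ (g : ℤ) (u : Fin 2 → ℤ), 0 < g ∧ IsPrimitive u ∧ s = g • u := by
  have hg : 0 < Int.gcd (s 0) (s 1) := by
    rw [Int.gcd_pos_iff]
    by_contra! h
    exact hs (funext fun i => by fin_cases i <;> simp [h.1, h.2])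
  refine ⟨Int.gcd (s 0) (s 1), ![s 0 / Int.gcd (s 0) (s 1), s 1 / Int.gcd (s 0) (s 1)],
    by exact_mod_cast hg, ?_, ?_⟩
  · rw [isPrimitive_iff_isCoprime, Int.isCoprime_iff_gcd_eq_one]
    exact Int.gcd_div_gcd_div_gcd hg
  · funext i
    fin_cases i
    · exact (Int.mul_ediv_cancel' (Int.gcd_dvd_left _ _)).symm
    · exact (Int.mul_ediv_cancel' (Int.gcd_dvd_right _ _)).symm

lemma eq_or_eq_neg_of_det_eq_zero {u v : Fin 2 → ℤ} (hu : IsPrimitive u) (hv : IsPrimitive v)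
    (h : u 0 * v 1 - u 1 * v 0 = 0) : v = u ∨ v = -u := by
  obtain ⟨r, s, hrs⟩ := isPrimitive_iff_isCoprime.1 hu
  have e : v = (r * v 0 + s * v 1) • u := by
    funext i
    fin_cases i
    · show v 0 = (r * v 0 + s * v 1) * u 0
      linear_combination (-v 0) * hrs - s * h
    · show v 1 = (r * v 0 + s * v 1) * u 1
      linear_combination (-v 1) * hrs + r * h
  rcases Int.isUnit_iff.1 (hv _ _ e) with h1 | h1
  · left; rw [h1, one_smul] at e; exact e
  · right; rw [h1, neg_one_smul] at e; exact e

/-- A primitive vector is determined by its half-plane of nonnegativity. -/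
lemma eq_of_halfPlane_le {u v : Fin 2 → ℤ} (hu : IsPrimitive u) (hv : IsPrimitive v)
    (h : ∀ n : Fin 2 → ℤ, 0 ≤ ∑ i, n i * u i → 0 ≤ ∑ i, n i * v i) : u = v := by
  simp only [Fin.sum_univ_two] at h
  have h1 := h (quarterTurn u) (by simp [quarterTurn]; linarith)
  have h2 := h (-quarterTurn u) (by simp [quarterTurn]; linarith)
  have h3 := h u (by nlinarith [mul_self_nonneg (u 0), mul_self_nonneg (u 1)])
  simp [quarterTurn] at h1 h2
  rcases eq_or_eq_neg_of_det_eq_zero hu hv (by linarith) with e | e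
  · exact e.symm
  · exfalso
    apply hu.ne_zero
    simp [e] at h3
    have h0 : u 0 = 0 := by nlinarith [mul_self_nonneg (u 0), mul_self_nonneg (u 1)]
    have h0' : u 1 = 0 := by nlinarith [mul_self_nonneg (u 0), mul_self_nonneg (u 1)]
    funext i
    fin_cases i
    · exact h0
    · exact h0'

/-- Parallel primitive vectors are equal or opposite, and if the first two of three distinct ones were
opposite, the relation would make the third parallel to them, hence equal to one of them. -/
lemma det_ne_zero_of_relation {u : Fin 3 → Fin 2 → ℤ} {w : Fin 3 → ℕ}
    (hu : ∀ i, IsPrimitive (u i)) (hw : ∀ i, 0 < w i) (huw : ∑ i, w i • u i = 0)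
    (hinj : Function.Injective u) : u 0 0 * u 1 1 - u 0 1 * u 1 0 ≠ 0 := by
  intro h
  have h1 : u 1 = -u 0 := by
    rcases eq_or_eq_neg_of_det_eq_zero (hu 0) (hu 1) h with e | e
    · exact absurd (hinj e) (by decide)
    · exact e
  have hw2 : (w 2 : ℤ) ≠ 0 := by exact_mod_cast (hw 2).ne'
  have c0 := congrFun huw 0
  have c1 := congrFun huw 1
  simp [Fin.sum_univ_three, h1] at c0 c1
  have h2 : u 0 0 * u 2 1 - u 0 1 * u 2 0 = 0 := by
    apply mul_left_cancel₀ hw2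
    linear_combination (u 0 0) * c1 - (u 0 1) * c0
  rcases eq_or_eq_neg_of_det_eq_zero (hu 0) (hu 2) h2 with e | e
  · exact absurd (hinj e) (by decide)
  · exact absurd (hinj (e.trans h1.symm)) (by decide)

lemma latticeToReal_zsmul (g : ℤ) (u : Fin 2 → ℤ) :
    latticeToReal (g • u) = (g : ℝ) • latticeToReal u := by
  funext i; simp [latticeToReal]

lemma latticeToReal_ne_zero {u : Fin 2 → ℤ} (h : u ≠ 0) : latticeToReal u ≠ 0 := by
  intro h0
  exact h (funext fun i => by simpa [latticeToReal] using congrFun h0 i)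

lemma exists_smul_eq_of_finrank_le_one {E : Type*} [AddCommGroup E] [Module ℝ E]
    {V : Submodule ℝ E} [FiniteDimensional ℝ V] (hV : Module.finrank ℝ V ≤ 1) {v w : E}
    (hv : v ∈ V) (hw : w ∈ V) (h0 : v ≠ 0) : ∃ c : ℝ, c • v = w := by
  have hv0 : (⟨v, hv⟩ : V) ≠ 0 := fun e => h0 (congrArg Subtype.val e)
  have : Nontrivial V := ⟨⟨_, _, hv0⟩⟩
  obtain ⟨c, hc⟩ := (finrank_eq_one_iff_of_nonzero' _ hv0).1
    (le_antisymm hV Module.finrank_pos) ⟨w, hw⟩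
  exact ⟨c, congrArg Subtype.val hc⟩

/-- A cone of dimension at most one of a fan is zero or the ray of a primitive vector. -/
lemma Fan.eq_bot_or_eq_ray (Δ : Fan 2) (τ : Δ.cones) (h : coneDim τ.1 ≤ 1) :
    τ.1 = ⊥ ∨ ∃ u, IsPrimitive u ∧ τ.1 = ray u := by
  obtain ⟨τ, hτ⟩ := τ
  obtain ⟨S, hS⟩ := Δ.rational τ hτ
  simp only at h ⊢
  by_cases h0 : ∀ s ∈ S, s = 0
  · left
    rw [hS, Submodule.span_eq_bot]
    rintro _ ⟨s, hs, rfl⟩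
    rw [h0 s hs]
    funext i; simp [latticeToReal]
  · right
    push Not at h0
    obtain ⟨s, hs, hs0⟩ := h0
    obtain ⟨g, u, hg, hu, rfl⟩ := exists_isPrimitive hs0
    have hg' : (0 : ℝ) < g := by exact_mod_cast hg
    have hSτ : ∀ s ∈ S, latticeToReal s ∈ τ := fun s hs => by
      rw [hS]; exact PointedCone.subset_hull ⟨s, hs, rfl⟩
    have huτ : latticeToReal u ∈ τ := by
      have := τ.smul_mem (inv_nonneg.2 hg'.le) (hSτ _ hs)
      rwa [latticeToReal_zsmul, smul_smul, inv_mul_cancel₀ hg'.ne', one_smul] at this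
    refine ⟨u, hu, le_antisymm ?_ ?_⟩
    · conv_lhs => rw [hS]
      refine Submodule.span_le.2 ?_
      rintro _ ⟨s', hs', rfl⟩
      have hu0 := latticeToReal_ne_zero hu.ne_zero
      obtain ⟨c, hc'⟩ := exists_smul_eq_of_finrank_le_one h (Submodule.subset_span huτ)
        (Submodule.subset_span (hSτ s' hs')) hu0
      rcases le_or_gt 0 c with h1 | h1
      · rw [← hc']
        exact (ray u).smul_mem h1 (PointedCone.subset_hull rfl)
      · exfalso
        apply hu0
        refine Δ.stronglyConvex τ hτ _ huτ ?_
        have := τ.smul_mem (inv_nonneg.2 (neg_nonneg.2 h1.le)) (hSτ s' hs')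
        rwa [← hc', smul_smul, inv_neg, neg_mul, inv_mul_cancel₀ h1.ne, neg_one_smul] at this
    · refine Submodule.span_le.2 ?_
      rintro _ rfl
      exact huτ

end Primitive

/-! ### Points of torically transverse maps -/

section Points

variable {Δ : Fan 2}

lemma mem_dualMonoid_bot {d : ℕ} (n : Fin d → ℤ) :
    n ∈ dualMonoid (⊥ : PointedCone ℝ (Fin d → ℝ)) := by
  rintro v rfl
  exact (pairing_zero_right n).ge

lemma Fan.exists_chart_bot_of_mem_bigTorus {d : ℕ} {Δ : Fan d} {P : Δ.Variety}
    (h : P ∈ Δ.bigTorus) :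
    ∃ (h0 : ⊥ ∈ Δ.cones) (y : Affine (⊥ : PointedCone ℝ (Fin d → ℝ))),
      P = Δ.chart ⟨⊥, h0⟩ y := by
  obtain ⟨⟨τ, hτ⟩, rfl, x, hx, -⟩ := h
  exact ⟨hτ, x, hx⟩

lemma Fan.chart_bot_mem_bigTorus {d : ℕ} {Δ : Fan d} (h0 : ⊥ ∈ Δ.cones)
    (y : Affine (⊥ : PointedCone ℝ (Fin d → ℝ))) : Δ.chart ⟨⊥, h0⟩ y ∈ Δ.bigTorus := by
  refine ⟨⟨⊥, h0⟩, rfl, y, rfl, fun n => iff_of_true ?_ ?_⟩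
  · exact y.monomial_ne_zero_of_neg_mem n.2 (mem_dualMonoid_bot _)
  · rintro v rfl
    exact pairing_zero_right _

lemma Fan.mem_regularAt_of_mem_bigTorus {d : ℕ} {Δ : Fan d} {P : Δ.Variety}
    (h : P ∈ Δ.bigTorus) (n : Fin d → ℤ) : n ∈ Δ.regularAt P := by
  obtain ⟨h0, y, rfl⟩ := Fan.exists_chart_bot_of_mem_bigTorus h
  exact Fan.mem_regularAt ⟨⊥, h0⟩ y ⟨n, mem_dualMonoid_bot n⟩

lemma Fan.laurent_ne_zero_of_mem_bigTorus {d : ℕ} {Δ : Fan d} {P : Δ.Variety}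
    (h : P ∈ Δ.bigTorus) (n : Fin d → ℤ) : Δ.laurent P n ≠ 0 := by
  obtain ⟨h0, y, rfl⟩ := Fan.exists_chart_bot_of_mem_bigTorus h
  rw [Fan.laurent_chart ⟨⊥, h0⟩ y ⟨n, mem_dualMonoid_bot n⟩]
  exact y.monomial_ne_zero_of_neg_mem _ (mem_dualMonoid_bot _)

/-- A torically transverse map sends each point to the big torus or to a toric prime divisor. -/
lemma IsToricallyTransverse.mem_bigTorus_or_mem_divisor {φ : P1 → Δ.Variety}
    (hφ : IsToricallyTransverse Δ φ) (q : P1) :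
    φ q ∈ Δ.bigTorus ∨ ∃ u, Δ.IsRayGenerator u ∧ φ q ∈ Δ.divisor u := by
  obtain ⟨τ, hτ⟩ := Fan.exists_mem_orbit (φ q)
  have hd : coneDim τ.1 ≤ 1 := by
    by_contra! h
    exact hφ.2 τ h q hτ
  rcases Δ.eq_bot_or_eq_ray τ hd with h | ⟨u, hu, h⟩
  · exact Or.inl ⟨τ, h, hτ⟩
  · exact Or.inr ⟨u, ⟨hu, h ▸ τ.2⟩, τ, h.ge, hτ⟩

/-- Splitting a monomial at a ray: `m = ⟨m, u⟩ n + m'` with `⟨n, u⟩ = 1` and `m' ∈ u^⊥`. -/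
lemma pairing_sub_smul {u n m : Fin 2 → ℤ} (hn : ∑ i, n i * u i = 1) :
    ∑ i, (m - (∑ i, m i * u i) • n) i * u i = 0 := by
  have : ∑ i, (m - (∑ i, m i * u i) • n) i * u i
      = ∑ i, m i * u i - (∑ i, m i * u i) * ∑ i, n i * u i := by
    simp only [Fin.sum_univ_two, Pi.sub_apply, Pi.smul_apply, smul_eq_mul]
    ring
  rw [this, hn, mul_one, sub_self]

/-- At a point of the chart of the ray `u` at which the equation of the divisor vanishes, only
the monomials in the half-plane of `u` are regular: a monomial that may be inverted lies in `u^⊥`. -/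
lemma Fan.pairing_nonneg_of_mem_regularAt {u : Fin 2 → ℤ} (hu : ray u ∈ Δ.cones)
    (x : Affine (ray u)) (n : dualMonoid (ray u)) (hn : ∑ i, n.1 i * u i = 1)
    (hx : x.monomial n = 0) {m : Fin 2 → ℤ} (hm : m ∈ Δ.regularAt (Δ.chart ⟨ray u, hu⟩ x)) :
    0 ≤ ∑ i, m i * u i := by
  obtain ⟨a, b, hb, rfl⟩ := Fan.exists_of_mem_regularAt (σ := ⟨ray u, hu⟩) hm
  have hb0 : ∑ i, b.1 i * u i = 0 := by
    by_contra hne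
    apply hb
    obtain ⟨k, hk⟩ := Int.eq_ofNat_of_zero_le (mem_dualMonoid_ray.1 b.2)
    have hb' : b.1 - k • n.1 ∈ dualMonoid (ray u) := by
      rw [mem_dualMonoid_ray]
      have := pairing_sub_smul (m := b.1) hn
      rw [hk, natCast_zsmul] at this
      exact this.ge
    have e : b = k • n + ⟨_, hb'⟩ := Subtype.ext (add_sub_cancel _ _).symm
    have hk0 : k ≠ 0 := by rintro rfl; exact hne (by simpa using hk)
    rw [e, x.monomial_add, x.monomial_nsmul, hx, zero_pow hk0, zero_mul]
  have ha := mem_dualMonoid_ray.1 a.2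
  simp only [Fin.sum_univ_two, Pi.sub_apply] at *
  linarith

end Points

/-! ### Affine coordinates on the projective line -/

section AffineCoordinate

variable {a b : Fin 2 → ℂ} (h : a 0 * b 1 - a 1 * b 0 ≠ 0)

lemma add_smul_ne_zero_of_det {a b : Fin 2 → ℂ} (h : a 0 * b 1 - a 1 * b 0 ≠ 0) (t : ℂ) : a + t • b ≠ 0 := by
  intro e
  have h0 : a 0 + t * b 0 = 0 := congrFun e 0
  have h1 : a 1 + t * b 1 = 0 := congrFun e 1
  exact h (by linear_combination b 1 * h0 - b 0 * h1)

lemma det_swap_ne_zero {a b : Fin 2 → ℂ} (h : a 0 * b 1 - a 1 * b 0 ≠ 0) :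
    b 0 * a 1 - b 1 * a 0 ≠ 0 := fun e => h (by linear_combination -e)

/-- The affine coordinate `t ↦ [a + t b]` on the projective line, for independent `a`, `b`. The
missing point `[b]` is the origin of the coordinate with `a` and `b` exchanged. -/
noncomputable def affinePt (t : ℂ) : P1 :=
  Projectivization.mk ℂ (a + t • b) (add_smul_ne_zero_of_det h t)

lemma affinePt_injective : Function.Injective (affinePt h) := by
  intro s t e
  obtain ⟨c, hc⟩ := (Projectivization.mk_eq_mk_iff' ℂ _ _ _ _).1 e
  have h0 : c * (a 0 + t * b 0) = a 0 + s * b 0 := congrFun hc 0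
  have h1 : c * (a 1 + t * b 1) = a 1 + s * b 1 := congrFun hc 1
  have hc1 : c = 1 := by
    apply mul_right_cancel₀ h
    linear_combination b 1 * h0 - b 0 * h1
  subst hc1
  apply mul_right_cancel₀ h
  linear_combination -a 0 * h1 + a 1 * h0

lemma affinePt_swap {s : ℂ} (hs : s ≠ 0) :
    affinePt (det_swap_ne_zero h) s = affinePt h s⁻¹ := by
  refine (Projectivization.mk_eq_mk_iff' ℂ _ _ _ _).2 ⟨s, ?_⟩
  rw [smul_add, smul_smul, mul_inv_cancel₀ hs, one_smul, add_comm]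

lemma exists_affinePt_eq (q : P1) :
    (∃ t, q = affinePt h t) ∨ q = affinePt (det_swap_ne_zero h) 0 := by
  induction q using Projectivization.ind with
  | h v hv =>
  set D := a 0 * b 1 - a 1 * b 0 with hD
  by_cases hα : v 0 * b 1 - v 1 * b 0 = 0
  · right
    refine (Projectivization.mk_eq_mk_iff' ℂ _ _ _ _).2 ⟨(a 0 * v 1 - a 1 * v 0) / D, ?_⟩
    funext i
    rw [zero_smul, add_zero, Pi.smul_apply, smul_eq_mul, div_mul_eq_mul_div, div_eq_iff h, hD]
    fin_cases i
    · show (a 0 * v 1 - a 1 * v 0) * b 0 = v 0 * _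
      linear_combination -a 0 * hα
    · show (a 0 * v 1 - a 1 * v 0) * b 1 = v 1 * _
      linear_combination -a 1 * hα
  · left
    refine ⟨(a 0 * v 1 - a 1 * v 0) / (v 0 * b 1 - v 1 * b 0),
      (Projectivization.mk_eq_mk_iff' ℂ _ _ _ _).2 ⟨(v 0 * b 1 - v 1 * b 0) / D, ?_⟩⟩
    funext i
    rw [Pi.smul_apply, Pi.add_apply, Pi.smul_apply, smul_eq_mul, smul_eq_mul,
      div_mul_eq_mul_div, div_eq_iff h, mul_add, ← mul_assoc, mul_div_cancel₀ _ hα, hD]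
    fin_cases i
    · show (v 0 * b 1 - v 1 * b 0) * a 0 + (a 0 * v 1 - a 1 * v 0) * b 0 = v 0 * _
      ring
    · show (v 0 * b 1 - v 1 * b 0) * a 1 + (a 0 * v 1 - a 1 * v 0) * b 1 = v 1 * _
      ring

/-- Values of binary forms in an affine coordinate, up to the choice of representatives. -/
lemma exists_formEval_affinePt (t : ℂ) : ∃ l : ℂ, l ≠ 0 ∧ (affinePt h t).rep = l • (a + t • b) ∧
    ∀ (e : ℕ) (F : MvPolynomial (Fin 2) ℂ), F.IsHomogeneous e →
      formEval F (affinePt h t) = l ^ e * MvPolynomial.eval (a + t • b) F := by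
  obtain ⟨l, hl⟩ := Projectivization.exists_smul_eq_mk_rep ℂ _ (add_smul_ne_zero_of_det h t)
  refine ⟨l, l.ne_zero, hl.symm, fun e F hF => ?_⟩
  rw [formEval, affinePt, ← hl, MvPolynomial.eval_eq', MvPolynomial.eval_eq', Finset.mul_sum]
  refine Finset.sum_congr rfl fun m hm => ?_
  have hm' : ∑ i, m i = e := by
    have := hF (MvPolynomial.mem_support_iff.1 hm)
    rwa [Finsupp.weight_apply, Finsupp.sum_fintype _ _ (by simp), Finset.sum_congr rfl
      (fun i _ => by simp : ∀ i ∈ Finset.univ, m i • (1 : Fin 2 → ℕ) i = m i)] at this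
  simp only [Units.smul_def, Pi.smul_apply, smul_eq_mul, mul_pow, Finset.prod_mul_distrib,
    Finset.prod_pow_eq_pow_sum, hm']
  ring

lemma analyticAt_eval (a b : Fin 2 → ℂ) (F : MvPolynomial (Fin 2) ℂ) (t : ℂ) :
    AnalyticAt ℂ (fun t : ℂ => MvPolynomial.eval (a + t • b) F) t := by
  have := AnalyticAt.aeval_mvPolynomial (𝕜 := ℂ) (z := t) (f := fun t : ℂ => a + t • b)
    (fun i => by simp only [Pi.add_apply, Pi.smul_apply, smul_eq_mul]; fun_prop) F
  refine this.congr (Eventually.of_forall fun s => ?_)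
  exact congrFun (congrArg DFunLike.coe (MvPolynomial.coe_aeval_eq_eval (a + s • b))) F

lemma eventually_affinePt_mem {W : Set P1} (hW : Wᶜ.Finite) {t₀ : ℂ} (ht : affinePt h t₀ ∈ W) :
    ∀ᶠ t in 𝓝 t₀, affinePt h t ∈ W := by
  have hf : (affinePt h ⁻¹' Wᶜ).Finite := hW.preimage (affinePt_injective h).injOn
  have ho : IsOpen (affinePt h ⁻¹' W) := by
    rw [← isClosed_compl_iff]; exact hf.isClosed
  exact ho.mem_nhds ht

lemma RegularOn.analyticAt {W : Set P1} {f : P1 → ℂ} (hf : RegularOn W f) (hW : Wᶜ.Finite) {t₀ : ℂ}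
    (ht : affinePt h t₀ ∈ W) : AnalyticAt ℂ (fun t => f (affinePt h t)) t₀ := by
  obtain ⟨e, F, G, hF, hG, hG0, hq⟩ := hf _ ht
  have hGt : MvPolynomial.eval (a + t₀ • b) G ≠ 0 := by
    obtain ⟨l, -, -, hl'⟩ := exists_formEval_affinePt h t₀
    rw [hl' e G hG] at hG0
    exact right_ne_zero_of_mul hG0
  refine ((analyticAt_eval a b F t₀).div (analyticAt_eval a b G t₀) hGt).congr ?_
  filter_upwards [eventually_affinePt_mem h hW ht,
    (analyticAt_eval a b G t₀).continuousAt.eventually_ne hGt] with t h1 h2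
  obtain ⟨l, hl, -, hl'⟩ := exists_formEval_affinePt h t
  rw [hq _ h1, hl' e F hF, hl' e G hG, mul_div_mul_left _ _ (pow_ne_zero _ hl)]
  · rfl
  rw [hl' e G hG]
  exact mul_ne_zero (pow_ne_zero _ hl) h2

lemma linearForm_isHomogeneous (q : P1) : (linearForm q).IsHomogeneous 1 := by
  refine MvPolynomial.IsHomogeneous.sub ?_ ?_
  · simpa using (MvPolynomial.isHomogeneous_C (Fin 2) (q.rep 1)).mul
      (MvPolynomial.isHomogeneous_X ℂ (0 : Fin 2))
  · simpa using (MvPolynomial.isHomogeneous_C (Fin 2) (q.rep 0)).mul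
      (MvPolynomial.isHomogeneous_X ℂ (1 : Fin 2))

lemma HasOrderAt.exists_analyticAt {W : Set P1} {f : P1 → ℂ} {k : ℕ} {t₀ : ℂ}
    (hf : HasOrderAt W f (affinePt h t₀) k) (hW : Wᶜ.Finite) (ht : affinePt h t₀ ∈ W) :
    ∃ g : ℂ → ℂ, AnalyticAt ℂ g t₀ ∧ g t₀ ≠ 0 ∧
      ∀ᶠ t in 𝓝 t₀, f (affinePt h t) = (t - t₀) ^ k * g t := by
  obtain ⟨e, F, G, hF, hG, hF0, hG0, hq⟩ := hf
  obtain ⟨l₀, hl₀, hrep, hl₀'⟩ := exists_formEval_affinePt h t₀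
  have hGt : MvPolynomial.eval (a + t₀ • b) G ≠ 0 := by
    rw [hl₀' _ G hG] at hG0
    exact right_ne_zero_of_mul hG0
  have hFt : MvPolynomial.eval (a + t₀ • b) F ≠ 0 := by
    rw [hl₀' _ F hF] at hF0
    exact right_ne_zero_of_mul hF0
  set c : ℂ := l₀ * (a 1 * b 0 - a 0 * b 1) with hc
  have hc0 : c ≠ 0 := mul_ne_zero hl₀ fun e => h (by linear_combination -e)
  have hlin : ∀ t : ℂ, MvPolynomial.eval (a + t • b) (linearForm (affinePt h t₀))
      = (t - t₀) * c := by
    intro t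
    simp only [linearForm, hrep, map_sub, map_mul, MvPolynomial.eval_C, MvPolynomial.eval_X,
      Pi.add_apply, Pi.smul_apply, smul_eq_mul, hc]
    ring
  refine ⟨fun t => c ^ k * MvPolynomial.eval (a + t • b) F / MvPolynomial.eval (a + t • b) G,
    (analyticAt_const.mul (analyticAt_eval a b F t₀)).div (analyticAt_eval a b G t₀) hGt,
    div_ne_zero (mul_ne_zero (pow_ne_zero _ hc0) hFt) hGt, ?_⟩
  filter_upwards [eventually_affinePt_mem h hW ht,
    (analyticAt_eval a b G t₀).continuousAt.eventually_ne hGt] with t h1 h2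
  obtain ⟨l, hl, -, hl'⟩ := exists_formEval_affinePt h t
  have hd : (linearForm (affinePt h t₀) ^ k * F).IsHomogeneous (e + k) := by
    have := ((linearForm_isHomogeneous (affinePt h t₀)).pow k).mul hF
    rwa [one_mul, add_comm] at this
  rw [hq _ h1, hl' _ _ hd, hl' _ G hG, mul_div_mul_left _ _ (pow_ne_zero _ hl), map_mul, map_pow,
    hlin, mul_pow]
  · ring
  · rw [hl' _ G hG]
    exact mul_ne_zero (pow_ne_zero _ hl) h2

/-- Three distinct points can be put at `0`, `1` and `∞`. -/
lemma exists_affinePt_normalized {q₀ q₁ q₂ : P1} (h01 : q₀ ≠ q₁) (h02 : q₀ ≠ q₂) (h12 : q₁ ≠ q₂) :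
    ∃ (a b : Fin 2 → ℂ) (h : a 0 * b 1 - a 1 * b 0 ≠ 0), affinePt h 0 = q₀ ∧ affinePt h 1 = q₁ ∧
      affinePt (det_swap_ne_zero h) 0 = q₂ := by
  have hmk : ∀ (a b : Fin 2 → ℂ) (h : a 0 * b 1 - a 1 * b 0 ≠ 0) (ha : a ≠ 0),
      affinePt h 0 = Projectivization.mk ℂ a ha := by
    intro a b h ha
    refine (Projectivization.mk_eq_mk_iff' ℂ _ _ _ _).2 ⟨1, by simp⟩
  have hdet : q₀.rep 0 * q₂.rep 1 - q₀.rep 1 * q₂.rep 0 ≠ 0 := by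
    intro e
    apply h02
    rw [← q₀.mk_rep, ← q₂.mk_rep, Projectivization.mk_eq_mk_iff']
    have h2 := q₂.rep_nonzero
    by_cases h20 : q₂.rep 0 = 0
    · have h21 : q₂.rep 1 ≠ 0 := fun h21 => h2 (funext fun i => by fin_cases i <;> assumption)
      refine ⟨q₀.rep 1 / q₂.rep 1, funext fun i => ?_⟩
      rw [Pi.smul_apply, smul_eq_mul, div_mul_eq_mul_div, div_eq_iff h21]
      fin_cases i
      · show q₀.rep 1 * q₂.rep 0 = q₀.rep 0 * q₂.rep 1
        linear_combination -e
      · rfl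
    · refine ⟨q₀.rep 0 / q₂.rep 0, funext fun i => ?_⟩
      rw [Pi.smul_apply, smul_eq_mul, div_mul_eq_mul_div, div_eq_iff h20]
      fin_cases i
      · rfl
      · show q₀.rep 0 * q₂.rep 1 = q₀.rep 1 * q₂.rep 0
        linear_combination e
  have e0 := (hmk _ _ hdet q₀.rep_nonzero).trans q₀.mk_rep
  have e2 := (hmk _ _ (det_swap_ne_zero hdet) q₂.rep_nonzero).trans q₂.mk_rep
  rcases exists_affinePt_eq hdet q₁ with ⟨t, ht⟩ | h1
  · have ht0 : t ≠ 0 := by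
      rintro rfl
      exact h01 (e0.symm.trans ht.symm)
    have h' : q₀.rep 0 * (t • q₂.rep) 1 - q₀.rep 1 * (t • q₂.rep) 0 ≠ 0 := by
      have := mul_ne_zero ht0 hdet
      intro e
      simp only [Pi.smul_apply, smul_eq_mul] at e
      exact this (by linear_combination e)
    refine ⟨q₀.rep, t • q₂.rep, h', ?_, ?_, ?_⟩
    · exact (hmk _ _ h' q₀.rep_nonzero).trans q₀.mk_rep
    · rw [ht]
      exact (Projectivization.mk_eq_mk_iff' ℂ _ _ _ _).2 ⟨1, by simp⟩
    · refine Eq.trans ?_ e2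
      exact (Projectivization.mk_eq_mk_iff' ℂ _ _ _ _).2 ⟨t, by simp⟩
  · exact absurd (h1.trans e2) h12

end AffineCoordinate

/-! ### Meromorphic functions with prescribed zeros and poles -/

section Meromorphic

/-- `f` is meromorphic at `z` with order `n`. -/
def HasMerOrder (f : ℂ → ℂ) (z : ℂ) (n : ℤ) : Prop :=
  MeromorphicAt f z ∧ meromorphicOrderAt f z = n

lemma HasMerOrder.mul {f g : ℂ → ℂ} {z : ℂ} {m n : ℤ} (hf : HasMerOrder f z m)
    (hg : HasMerOrder g z n) : HasMerOrder (fun t => f t * g t) z (m + n) := by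
  refine ⟨hf.1.mul hg.1, ?_⟩
  have := meromorphicOrderAt_mul hf.1 hg.1
  rw [hf.2, hg.2] at this
  exact_mod_cast this

lemma HasMerOrder.zpow {f : ℂ → ℂ} {z : ℂ} {m : ℤ} (hf : HasMerOrder f z m) (k : ℤ) :
    HasMerOrder (fun t => f t ^ k) z (k * m) := by
  refine ⟨hf.1.zpow k, ?_⟩
  have := meromorphicOrderAt_zpow hf.1 (n := k)
  rw [hf.2] at this
  exact_mod_cast this

lemma HasMerOrder.congr {f g : ℂ → ℂ} {z : ℂ} {m : ℤ} (hf : HasMerOrder f z m)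
    (h : f =ᶠ[𝓝[≠] z] g) : HasMerOrder g z m :=
  ⟨hf.1.congr h, (meromorphicOrderAt_congr h).symm.trans hf.2⟩

lemma hasMerOrder_of_analyticAt {f : ℂ → ℂ} {z : ℂ} (hf : AnalyticAt ℂ f z) (h0 : f z ≠ 0) :
    HasMerOrder f z 0 := by
  refine ⟨hf.meromorphicAt, (meromorphicOrderAt_eq_int_iff hf.meromorphicAt).2 ⟨f, hf, h0, ?_⟩⟩
  simp

lemma hasMerOrder_sub_self (z : ℂ) : HasMerOrder (fun t => t - z) z 1 :=
  ⟨by fun_prop, meromorphicOrderAt_id_sub_const⟩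

lemma HasMerOrder.eventually_ne_zero {f : ℂ → ℂ} {z : ℂ} {m : ℤ} (hf : HasMerOrder f z m) :
    ∀ᶠ t in 𝓝[≠] z, f t ≠ 0 :=
  (meromorphicOrderAt_ne_top_iff_eventually_ne_zero hf.1).1 (by rw [hf.2]; simp)

/-- Liouville's theorem for functions with removable singularities. -/
lemma eq_of_tendsto_cocompact_of_order_nonneg {f : ℂ → ℂ} {S : Set ℂ} {c : ℂ}
    (hmer : ∀ z, MeromorphicAt f z) (hord : ∀ z, 0 ≤ meromorphicOrderAt f z)
    (hS : S.Finite) (han : ∀ z ∉ S, AnalyticAt ℂ f z) (hc : Tendsto f (cocompact ℂ) (𝓝 c)) :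
    ∀ z ∉ S, f z = c := by
  have hmer' : MeromorphicOn f Set.univ := fun z _ => hmer z
  set g := toMeromorphicNFOn f Set.univ with hg
  have hgan : ∀ z, AnalyticAt ℂ g z := fun z => by
    refine ((meromorphicNFOn_toMeromorphicNFOn f Set.univ)
      (Set.mem_univ z)).meromorphicOrderAt_nonneg_iff_analyticAt.1 ?_
    rw [meromorphicOrderAt_toMeromorphicNFOn hmer' (Set.mem_univ z)]
    exact hord z
  have hfg : ∀ z ∉ S, f z = g z := fun z hz => by
    have := (ContinuousAt.eventuallyEq_nhds_iff_eventuallyEq_nhdsNE (hgan z).continuousAt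
      (han z hz).continuousAt).1 (hmer'.toMeromorphicNFOn_eq_self_on_nhdsNE (Set.mem_univ z))
    exact this.self_of_nhds.symm
  have hev : f =ᶠ[cocompact ℂ] g := by
    filter_upwards [hS.isCompact.compl_mem_cocompact] with z hz using hfg z hz
  have hdiff : Differentiable ℂ g := fun z => (hgan z).differentiableAt
  have := hdiff.eq_const_of_tendsto_cocompact (hc.congr' hev)
  intro z hz
  rw [hfg z hz, this]
  rfl

lemma hasMerOrder_id_of_ne {z : ℂ} (hz : z ≠ 0) : HasMerOrder (fun t => t) z 0 :=
  hasMerOrder_of_analyticAt analyticAt_id hz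

/-- A function on the projective line (with coordinate `t` near finite points and `s = 1 / t` near
infinity) with order `α` at `0`, order `β` at `1`, order `-α - β` at infinity and no other zeros or
poles is a multiple of `t ^ α * (t - 1) ^ β`. -/
lemma exists_eq_const_mul_zpow {f F : ℂ → ℂ} {α β : ℤ}
    (h0 : HasMerOrder f 0 α) (h1 : HasMerOrder f 1 β)
    (han : ∀ z, z ≠ 0 → z ≠ 1 → AnalyticAt ℂ f z ∧ f z ≠ 0)
    (hF : HasMerOrder F 0 (-α - β)) (hFf : ∀ s, s ≠ 0 → F s = f s⁻¹) :
    ∃ c : ℂ, c ≠ 0 ∧ ∀ z, z ≠ 0 → z ≠ 1 → f z = c * (z ^ α * (z - 1) ^ β) := by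
  set H : ℂ → ℂ := fun t => f t * (t ^ (-α) * (t - 1) ^ (-β)) with hH
  have horder : ∀ z, HasMerOrder H z 0 := by
    intro z
    by_cases hz0 : z = 0
    · subst hz0
      have e1 : HasMerOrder (fun t : ℂ => t) 0 1 := by simpa using hasMerOrder_sub_self 0
      have e2 : HasMerOrder (fun t : ℂ => t - 1) 0 0 :=
        hasMerOrder_of_analyticAt (by fun_prop) (by simp)
      simpa [hH] using h0.mul ((e1.zpow (-α)).mul (e2.zpow (-β)))
    by_cases hz1 : z = 1
    · subst hz1
      simpa [hH] using h1.mul (((hasMerOrder_id_of_ne one_ne_zero).zpow (-α)).mul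
        ((hasMerOrder_sub_self 1).zpow (-β)))
    have e1 := hasMerOrder_id_of_ne hz0
    have e2 : HasMerOrder (fun t : ℂ => t - 1) z 0 :=
      hasMerOrder_of_analyticAt (by fun_prop) (sub_ne_zero.2 hz1)
    have e3 := hasMerOrder_of_analyticAt (han z hz0 hz1).1 (han z hz0 hz1).2
    simpa [hH] using e3.mul ((e1.zpow (-α)).mul (e2.zpow (-β)))
  -- In the coordinate `s` the function `H` is `F s * s ^ (α + β) * (1 - s) ^ (-β)`.
  have hinf : HasMerOrder (fun s => F s * (s ^ (α + β) * (1 - s) ^ (-β))) 0 0 := by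
    have e1 : HasMerOrder (fun t : ℂ => t) 0 1 := by simpa using hasMerOrder_sub_self 0
    have e2 : HasMerOrder (fun t : ℂ => 1 - t) 0 0 :=
      hasMerOrder_of_analyticAt (by fun_prop) (by simp)
    have := hF.mul ((e1.zpow (α + β)).mul (e2.zpow (-β)))
    simpa using this
  obtain ⟨c, hc0, hc⟩ := (tendsto_ne_zero_iff_meromorphicOrderAt_eq_zero hinf.1).2
    (by simpa using hinf.2)
  have hlim : Tendsto H (cocompact ℂ) (𝓝 c) := by
    have hinv : Tendsto (fun t : ℂ => t⁻¹) (cocompact ℂ) (𝓝[≠] 0) := by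
      rw [← Metric.cobounded_eq_cocompact, ← Filter.inv_cobounded₀]
      exact tendsto_map
    refine (hc.comp hinv).congr' ?_
    filter_upwards [(isCompact_singleton (x := (0 : ℂ))).compl_mem_cocompact] with t ht
    have ht0 : t ≠ 0 := ht
    have e : (1 - t⁻¹ : ℂ) = (t - 1) * t⁻¹ := by field_simp
    simp only [Function.comp, hH]
    rw [hFf _ (inv_ne_zero ht0), inv_inv, e, mul_zpow, zpow_add₀ (inv_ne_zero ht0), inv_zpow',
      inv_zpow', inv_zpow', neg_neg, zpow_neg t β]
    have := zpow_ne_zero β ht0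
    field_simp
  have key := eq_of_tendsto_cocompact_of_order_nonneg (S := {0, 1}) (fun z => (horder z).1)
    (fun z => by rw [(horder z).2]; simp) (by simp) (fun z hz => by
      simp only [Set.mem_insert_iff, Set.mem_singleton_iff, not_or] at hz
      exact (han z hz.1 hz.2).1.mul ((analyticAt_id.zpow hz.1).mul
        ((analyticAt_id.sub analyticAt_const).zpow (sub_ne_zero.2 hz.2)))) hlim
  refine ⟨c, hc0, fun z hz0 hz1 => ?_⟩
  have hk := key z (by simp [hz0, hz1])
  rw [← hk]
  simp only [hH, zpow_neg]
  have := zpow_ne_zero α hz0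
  have := zpow_ne_zero β (sub_ne_zero.2 hz1)
  field_simp

end Meromorphic

/-! ### Laurent monomials along a line -/

section AlongLine

variable {Δ : Fan 2} {φ : P1 → Δ.Variety} {a b : Fin 2 → ℂ} (h : a 0 * b 1 - a 1 * b 0 ≠ 0)

/-- Along a morphism, all Laurent monomials are analytic at a point that is sent to the big torus. The
chart given by the morphism need not be that of the torus, so a monomial is first written as a
quotient of two monomials of that chart. -/
lemma IsMorphism.analyticAt_laurent (hφ : IsMorphism Δ φ) {t₀ : ℂ}
    (ht : φ (affinePt h t₀) ∈ Δ.bigTorus) (n : Fin 2 → ℤ) :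
    AnalyticAt ℂ (fun t => Δ.laurent (φ (affinePt h t)) n) t₀ := by
  obtain ⟨σ, W, x, hq, hW, hx, hreg⟩ := hφ (affinePt h t₀)
  have hn := Fan.mem_regularAt_of_mem_bigTorus ht n
  rw [hx _ hq] at hn
  obtain ⟨m, m', hm', rfl⟩ := Fan.exists_of_mem_regularAt hn
  have h1 := (hreg m).analyticAt h hW hq
  have h2 := (hreg m').analyticAt h hW hq
  refine (h1.div h2 hm').congr ?_
  filter_upwards [eventually_affinePt_mem h hW hq, h2.continuousAt.eventually_ne hm'] with t e1 e2
  rw [hx _ e1, Fan.laurent_chart_sub _ _ _ _ e2]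
  rfl

lemma HasLocalMultiplicity.analyticAt_laurent {u : Fin 2 → ℤ} {k : ℕ} {t₀ : ℂ}
    (hm : HasLocalMultiplicity Δ φ u (affinePt h t₀) k) {m : Fin 2 → ℤ}
    (hmu : 0 ≤ ∑ i, m i * u i) :
    AnalyticAt ℂ (fun t => Δ.laurent (φ (affinePt h t)) m) t₀ := by
  obtain ⟨hu, W, x, n, hq, hW, hx, hreg, hn, hord⟩ := hm
  have hm : m ∈ dualMonoid (ray u) := mem_dualMonoid_ray.2 hmu
  refine ((hreg ⟨m, hm⟩).analyticAt h hW hq).congr ?_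
  filter_upwards [eventually_affinePt_mem h hW hq] with t ht
  rw [hx _ ht]
  exact (Fan.laurent_chart ⟨ray u, hu⟩ (x _) ⟨m, hm⟩).symm

/-- At a point of local multiplicity `k` with the divisor of `u`, the pullback of the Laurent
monomial `z^m` has order `k * ⟨m, u⟩`. -/
lemma HasLocalMultiplicity.hasMerOrder_laurent {u : Fin 2 → ℤ} {k : ℕ} {t₀ : ℂ}
    (hm : HasLocalMultiplicity Δ φ u (affinePt h t₀) k) (m : Fin 2 → ℤ) :
    HasMerOrder (fun t => Δ.laurent (φ (affinePt h t)) m) t₀ (k * ∑ i, m i * u i) := by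
  obtain ⟨hu, W, x, n, hq, hW, hx, hreg, hn, hord⟩ := hm
  obtain ⟨g, hg, hg0, hfg⟩ := hord.exists_analyticAt h hW hq
  have hn1 : HasMerOrder (fun t => (x (affinePt h t)).monomial n) t₀ k := by
    have := (((hasMerOrder_sub_self t₀).zpow k).mul (hasMerOrder_of_analyticAt hg hg0))
    simp only [mul_one, add_zero, zpow_natCast] at this
    exact this.congr ((hfg.filter_mono nhdsWithin_le_nhds).mono fun t ht => ht.symm)
  set l := ∑ i, m i * u i with hl
  have hm0 : ∑ i, (m - l • n.1) i * u i = 0 := pairing_sub_smul hn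
  have hm1 : m - l • n.1 ∈ dualMonoid (ray u) := mem_dualMonoid_ray.2 hm0.ge
  have hm2 : -(m - l • n.1) ∈ dualMonoid (ray u) := mem_dualMonoid_ray.2 (by
    simp only [Pi.neg_apply, neg_mul, Finset.sum_neg_distrib, hm0, neg_zero, le_refl])
  have h2 := hasMerOrder_of_analyticAt ((hreg ⟨_, hm1⟩).analyticAt h hW hq)
    ((x _).monomial_ne_zero_of_neg_mem hm1 hm2)
  have h3 := (hn1.zpow l).mul h2
  rw [add_zero, mul_comm l] at h3
  refine h3.congr ?_
  filter_upwards [(eventually_affinePt_mem h hW hq).filter_mono nhdsWithin_le_nhds,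
    hn1.eventually_ne_zero] with t e1 e2
  rw [hx _ e1]
  obtain ⟨l₁, l₂, e⟩ : ∃ l₁ l₂ : ℕ, l = l₁ - l₂ := ⟨l.toNat, (-l).toNat, by omega⟩
  have em : m = (l₁ • n + ⟨_, hm1⟩ : dualMonoid (ray u)).1 - (l₂ • n : dualMonoid (ray u)).1 := by
    show m = (l₁ • n.1 + (m - l • n.1)) - l₂ • n.1
    rw [e, sub_smul]
    simp only [natCast_zsmul]
    abel
  conv_rhs => rw [em]
  rw [Fan.laurent_chart_sub ⟨ray u, hu⟩ (x _) (l₁ • n + ⟨_, hm1⟩) (l₂ • n)]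
  · have ez : (x (affinePt h t)).monomial n ^ l =
        (x (affinePt h t)).monomial n ^ l₁ / (x (affinePt h t)).monomial n ^ l₂ := by
      rw [e, zpow_sub₀ e2, zpow_natCast, zpow_natCast]
    rw [Affine.monomial_add, Affine.monomial_nsmul, Affine.monomial_nsmul, ez]
    ring
  · rw [Affine.monomial_nsmul]
    exact pow_ne_zero _ e2

/-- At a point of positive multiplicity with the divisor of `u`, exactly the monomials in the
half-plane of `u` are regular. -/
lemma HasLocalMultiplicity.mem_regularAt_iff {u : Fin 2 → ℤ} {k : ℕ} {q : P1}
    (hm : HasLocalMultiplicity Δ φ u q k) (hk : 0 < k) {m : Fin 2 → ℤ} :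
    m ∈ Δ.regularAt (φ q) ↔ 0 ≤ ∑ i, m i * u i := by
  obtain ⟨hu, W, x, n, hq, hW, hx, hreg, hn, e, F, G, hF, hG, hF0, hG0, hord⟩ := hm
  rw [hx _ hq]
  constructor
  · refine Fan.pairing_nonneg_of_mem_regularAt hu (x q) n hn ?_
    have h1 : formEval (linearForm q ^ k * F) q = 0 := by
      have : MvPolynomial.eval q.rep (linearForm q) = 0 := by
        simp only [linearForm, map_sub, map_mul, MvPolynomial.eval_C, MvPolynomial.eval_X]
        ring
      rw [formEval, map_mul, map_pow, this, zero_pow hk.ne', zero_mul]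
    have h2 := hord q hq hG0
    rw [h1, zero_div] at h2
    exact h2
  · intro hmu
    exact Fan.mem_regularAt ⟨ray u, hu⟩ (x q) ⟨m, mem_dualMonoid_ray.2 hmu⟩

end AlongLine

/-! ### Germs of parametrized curves -/

section Germs

/-- Near `p`, the map `γ` on `D` is proper: the preimage of some neighbourhood of `p` lies in a
compact subset of `D`. -/
def ProperNear {E : Type*} [TopologicalSpace E] (γ : ℂ → E) (D : Set ℂ) (p : E) : Prop :=
  ∃ U ∈ 𝓝 p, ∃ K, IsCompact K ∧ K ⊆ D ∧ ∀ t ∈ D, γ t ∈ U → t ∈ K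

/-- The points of the curve near `p` come from parameters near the fibre of `p`. -/
lemma ProperNear.exists_isOpen {E : Type*} [TopologicalSpace E] [T2Space E] {γ : ℂ → E}
    {D O : Set ℂ} {p : E} (hp : ProperNear γ D p) (hγ : ContinuousOn γ D) (hO : IsOpen O)
    (hfib : ∀ t ∈ D, γ t = p → t ∈ O) :
    ∃ U, IsOpen U ∧ p ∈ U ∧ ∀ t ∈ D, γ t ∈ U → t ∈ O := by
  obtain ⟨U₀, hU₀, K, hK, hKD, hsub⟩ := hp
  have hc : IsClosed (γ '' (K \ O)) :=
    ((hK.diff hO).image_of_continuousOn (hγ.mono (Set.sdiff_subset.trans hKD))).isClosed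
  refine ⟨interior U₀ ∩ (γ '' (K \ O))ᶜ, isOpen_interior.inter hc.isOpen_compl,
    ⟨mem_interior_iff_mem_nhds.2 hU₀, ?_⟩, fun t ht h => ?_⟩
  · rintro ⟨t, ht, e⟩
    exact ht.2 (hfib t (hKD ht.1) e)
  · by_contra htO
    exact h.2 ⟨t, ⟨hsub t ht (interior_subset h.1), htO⟩, rfl⟩

/-- If `p` has a single preimage, at which some coordinate is immersive, then the curve is smooth
at `p`. -/
lemma germIso_univ_of_fiber_subsingleton {k : ℕ} {γ : ℂ → Fin k → ℂ} {D : Set ℂ} (hD : IsOpen D)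
    (hγ : AnalyticOnNhd ℂ γ D) {t₀ : ℂ} (ht₀ : t₀ ∈ D) (hp : ProperNear γ D (γ t₀))
    (hfib : ∀ t ∈ D, γ t = γ t₀ → t = t₀) (i : Fin k) (hi : deriv (fun t => γ t i) t₀ ≠ 0) :
    GermIso (γ '' D) (γ t₀) (Set.univ : Set ℂ) 0 := by
  have han : AnalyticAt ℂ (fun t => γ t i) t₀ :=
    ((ContinuousLinearMap.proj (R := ℂ) (φ := fun _ : Fin k => ℂ) i).analyticAt _).comp (hγ t₀ ht₀)
  set ψ := han.hasStrictDerivAt.localInverse _ _ _ hi with hψ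
  have hψan : AnalyticAt ℂ ψ (γ t₀ i) := han.analyticAt_localInverse hi
  have hleft : ∀ᶠ t in 𝓝 t₀, ψ (γ t i) = t :=
    HasStrictDerivAt.eventually_left_inverse han.hasStrictDerivAt hi
  obtain ⟨O, hO, hOo, htO⟩ := eventually_nhds_iff.1 (hleft.and (hD.mem_nhds ht₀))
  obtain ⟨U₁, hU₁, hU₁o, htU₁⟩ := eventually_nhds_iff.1 hψan.eventually_analyticAt
  obtain ⟨U, hUo, htU, hU⟩ := hp.exists_isOpen hγ.continuousOn hOo fun t ht e => by
    rw [hfib t ht e]; exact htO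
  set U' : Set (Fin k → ℂ) := U ∩ (fun y => y i) ⁻¹' U₁ with hU'
  have hU'o : IsOpen U' := hUo.inter (hU₁o.preimage (continuous_apply i))
  have hshift : Continuous fun s : ℂ => t₀ + s := by fun_prop
  have hVo : IsOpen ((fun s : ℂ => t₀ + s) ⁻¹' (O ∩ γ ⁻¹' U')) :=
    ((hγ.continuousOn.mono fun t ht => (hO t ht).2).isOpen_inter_preimage hOo hU'o).preimage hshift
  refine ⟨⟨t₀, ht₀, rfl⟩, trivial, U', (fun s : ℂ => t₀ + s) ⁻¹' (O ∩ γ ⁻¹' U'),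
    fun y => ψ (y i) - t₀, fun s => γ (t₀ + s), hU'o, hVo, ⟨htU, htU₁⟩, ?_, ?_, ?_, ?_, ?_, ?_,
    ?_, ?_⟩
  · show t₀ + 0 ∈ O ∩ γ ⁻¹' U'
    rw [add_zero]
    exact ⟨htO, htU, htU₁⟩
  · intro y hy
    have h1 : AnalyticAt ℂ (fun y : Fin k → ℂ => y i) y :=
      (ContinuousLinearMap.proj (R := ℂ) (φ := fun _ : Fin k => ℂ) i).analyticAt y
    exact (AnalyticAt.fun_comp (f := fun y : Fin k → ℂ => y i) (hU₁ _ hy.2) h1).sub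
      analyticAt_const
  · intro s hs
    exact AnalyticAt.fun_comp (f := fun s : ℂ => t₀ + s) (hγ _ (hO _ hs.1).2) (by fun_prop)
  · show ψ (γ t₀ i) - t₀ = 0
    rw [(hO _ htO).1, sub_self]
  · rintro _ ⟨⟨t, ht, rfl⟩, htU'⟩
    refine ⟨trivial, ?_⟩
    have htO' := hU t ht htU'.1
    show t₀ + (ψ (γ t i) - t₀) ∈ O ∩ γ ⁻¹' U'
    rw [(hO _ htO').1, add_sub_cancel]
    exact ⟨htO', htU'⟩
  · rintro s ⟨-, hs⟩
    exact ⟨⟨t₀ + s, (hO _ hs.1).2, rfl⟩, hs.2⟩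
  · rintro _ ⟨⟨t, ht, rfl⟩, htU'⟩
    show γ (t₀ + (ψ (γ t i) - t₀)) = γ t
    rw [(hO _ (hU t ht htU'.1)).1, add_sub_cancel]
  · rintro s ⟨-, hs⟩
    show ψ (γ (t₀ + s) i) - t₀ = s
    rw [(hO _ hs.1).1, add_sub_cancel_left]

/-- The invertible `2 × 2` matrix with rows `(a, b)` and `(c, d)`. -/
noncomputable def matrixEquiv (a b c d : ℂ) (h : a * d - b * c ≠ 0) : (ℂ × ℂ) ≃L[ℂ] (ℂ × ℂ) :=
  ContinuousLinearEquiv.equivOfInverse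
    ((a • ContinuousLinearMap.fst ℂ ℂ ℂ + b • ContinuousLinearMap.snd ℂ ℂ ℂ).prod
      (c • ContinuousLinearMap.fst ℂ ℂ ℂ + d • ContinuousLinearMap.snd ℂ ℂ ℂ))
    (((a * d - b * c)⁻¹ •
      (d • ContinuousLinearMap.fst ℂ ℂ ℂ - b • ContinuousLinearMap.snd ℂ ℂ ℂ)).prod
      ((a * d - b * c)⁻¹ •
        (a • ContinuousLinearMap.snd ℂ ℂ ℂ - c • ContinuousLinearMap.fst ℂ ℂ ℂ)))
    (by
      rintro ⟨x, y⟩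
      simp
      constructor
      · rw [inv_mul_eq_div, div_eq_iff h]; ring
      · rw [inv_mul_eq_div, div_eq_iff h]; ring)
    (by
      rintro ⟨x, y⟩
      simp
      constructor
      · rw [← mul_right_inj' h]
        linear_combination (a * (d * x - b * y) + b * (a * y - c * x)) * mul_inv_cancel₀ h
      · rw [← mul_right_inj' h]
        linear_combination (c * (d * x - b * y) + d * (a * y - c * x)) * mul_inv_cancel₀ h)

/-- If `p` has exactly two preimages, with independent tangent vectors, then the curve has a node
at `p`. -/
lemma germIso_node_of_fiber_pair {k : ℕ} {γ : ℂ → Fin k → ℂ} {D : Set ℂ} (hD : IsOpen D)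
    (hγ : AnalyticOnNhd ℂ γ D) {t₀ t₁ : ℂ} (ht₀ : t₀ ∈ D) (ht₁ : t₁ ∈ D)
    (h01 : γ t₁ = γ t₀) (hp : ProperNear γ D (γ t₀))
    (hfib : ∀ t ∈ D, γ t = γ t₀ → t = t₀ ∨ t = t₁) (i j : Fin k)
    (hij : deriv (fun t => γ t i) t₀ * deriv (fun t => γ t j) t₁
      - deriv (fun t => γ t i) t₁ * deriv (fun t => γ t j) t₀ ≠ 0) :
    GermIso (γ '' D) (γ t₀) {c : ℂ × ℂ | c.1 * c.2 = 0} 0 := by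
  have hco : ∀ i, ∀ t ∈ D, AnalyticAt ℂ (fun t => γ t i) t := fun i t ht =>
    ((ContinuousLinearMap.proj (R := ℂ) (φ := fun _ : Fin k => ℂ) i).analyticAt _).comp (hγ t ht)
  -- The two branches are added to give a local chart of a surface that contains both.
  set g : ℂ × ℂ → Fin k → ℂ := fun s => γ (t₀ + s.1) + γ (t₁ + s.2) - γ t₀ with hg
  set pr : (Fin k → ℂ) → ℂ × ℂ := fun y => (y i, y j) with hpr
  have hpran : ∀ y, AnalyticAt ℂ pr y := fun y =>
    ((ContinuousLinearMap.proj (R := ℂ) (φ := fun _ : Fin k => ℂ) i).analyticAt y).prod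
      ((ContinuousLinearMap.proj (R := ℂ) (φ := fun _ : Fin k => ℂ) j).analyticAt y)
  have hgan : ∀ s : ℂ × ℂ, t₀ + s.1 ∈ D → t₁ + s.2 ∈ D → AnalyticAt ℂ g s := fun s h0 h1 =>
    ((AnalyticAt.fun_comp (f := fun s : ℂ × ℂ => t₀ + s.1) (hγ _ h0)
      (analyticAt_const.add analyticAt_fst)).add
      (AnalyticAt.fun_comp (f := fun s : ℂ × ℂ => t₁ + s.2) (hγ _ h1)
      (analyticAt_const.add analyticAt_snd))).sub
      analyticAt_const
  have hg0 : ∀ s, g (s, 0) = γ (t₀ + s) := fun s => by simp [hg, h01]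
  have hg1 : ∀ s, g (0, s) = γ (t₁ + s) := fun s => by simp [hg]
  have hΨan : AnalyticAt ℂ (fun s => pr (g s)) 0 :=
    AnalyticAt.fun_comp (f := g) (hpran _) (hgan 0 (by simpa using ht₀) (by simpa using ht₁))
  have hΨ : HasStrictFDerivAt (fun s => pr (g s))
      (matrixEquiv _ _ _ _ hij : ℂ × ℂ →L[ℂ] ℂ × ℂ) 0 := by
    have hf : HasStrictFDerivAt (fun s : ℂ × ℂ => t₀ + s.1) (ContinuousLinearMap.fst ℂ ℂ ℂ) 0 :=
      hasStrictFDerivAt_fst.const_add t₀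
    have hs : HasStrictFDerivAt (fun s : ℂ × ℂ => t₁ + s.2) (ContinuousLinearMap.snd ℂ ℂ ℂ) 0 :=
      hasStrictFDerivAt_snd.const_add t₁
    have hc : ∀ i, HasStrictFDerivAt (fun s => g s i)
        (deriv (fun t => γ t i) t₀ • ContinuousLinearMap.fst ℂ ℂ ℂ
          + deriv (fun t => γ t i) t₁ • ContinuousLinearMap.snd ℂ ℂ ℂ) 0 := fun i => by
      have h0 : HasStrictDerivAt (fun t => γ t i) (deriv (fun t => γ t i) t₀)
          (t₀ + (0 : ℂ × ℂ).1) := by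
        simpa using (hco i t₀ ht₀).hasStrictDerivAt
      have h1 : HasStrictDerivAt (fun t => γ t i) (deriv (fun t => γ t i) t₁)
          (t₁ + (0 : ℂ × ℂ).2) := by
        simpa using (hco i t₁ ht₁).hasStrictDerivAt
      exact ((h0.comp_hasStrictFDerivAt (f := fun s : ℂ × ℂ => t₀ + s.1) _ hf).add 
        (h1.comp_hasStrictFDerivAt (f := fun s : ℂ × ℂ => t₁ + s.2) _ hs)).sub_const _
    exact (hc i).prodMk (hc j)
  set R := hΨ.toOpenPartialHomeomorph _ with hR
  have hR0 : (0 : ℂ × ℂ) ∈ R.source := HasStrictFDerivAt.mem_toOpenPartialHomeomorph_source _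
  have hΦan : AnalyticAt ℂ R.symm (pr (g 0)) :=
    R.analyticAt_symm' hR0 hΨan hΨ.hasFDerivAt.fderiv
  have hleft : ∀ᶠ s in 𝓝 (0 : ℂ × ℂ), R.symm (pr (g s)) = s :=
    by
    filter_upwards [R.open_source.mem_nhds hR0] with s hs using R.left_inv hs
  have hDev : ∀ᶠ s in 𝓝 (0 : ℂ × ℂ), t₀ + s.1 ∈ D ∧ t₁ + s.2 ∈ D := by
    have hc0 : Continuous fun s : ℂ × ℂ => t₀ + s.1 := by fun_prop
    have hc1 : Continuous fun s : ℂ × ℂ => t₁ + s.2 := by fun_prop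
    exact (hc0.continuousAt.eventually_mem (hD.mem_nhds (by simpa using ht₀))).and
      (hc1.continuousAt.eventually_mem (hD.mem_nhds (by simpa using ht₁)))
  obtain ⟨N, hN, hNo, h0N⟩ := eventually_nhds_iff.1 (hleft.and hDev)
  obtain ⟨U₁, hU₁, hU₁o, htU₁⟩ := eventually_nhds_iff.1 hΦan.eventually_analyticAt
  have hO : IsOpen ({t : ℂ | (t - t₀, (0 : ℂ)) ∈ N} ∪ {t : ℂ | ((0 : ℂ), t - t₁) ∈ N}) :=
    (hNo.preimage (by fun_prop)).union (hNo.preimage (by fun_prop))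
  obtain ⟨U, hUo, htU, hU⟩ := hp.exists_isOpen hγ.continuousOn hO fun t ht e => by
    rcases hfib t ht e with rfl | rfl
    · left; simpa [Prod.zero_eq_mk] using h0N
    · right; simpa [Prod.zero_eq_mk] using h0N
  have hp0 : g 0 = γ t₀ := by simpa [Prod.zero_eq_mk] using hg0 0
  set U' : Set (Fin k → ℂ) := U ∩ pr ⁻¹' U₁ with hU'
  have hprc : Continuous pr := by fun_prop
  have hU'o : IsOpen U' := hUo.inter (hU₁o.preimage hprc)
  have hgc : ContinuousOn g N := fun s hs =>
    (hgan s (hN s hs).2.1 (hN s hs).2.2).continuousAt.continuousWithinAt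
  -- A point of the curve near `p` is `g s` for some `s` near the origin on one of the two axes.
  have hpar : ∀ y ∈ γ '' D ∩ U', ∃ s ∈ N, s.1 * s.2 = 0 ∧ g s = y := by
    rintro _ ⟨⟨t, ht, rfl⟩, htU'⟩
    rcases hU t ht htU'.1 with h | h
    · exact ⟨_, h, by simp, by rw [hg0, add_sub_cancel]⟩
    · exact ⟨_, h, by simp, by rw [hg1, add_sub_cancel]⟩
  refine ⟨⟨t₀, ht₀, rfl⟩, by simp, U', N ∩ g ⁻¹' U', fun y => R.symm (pr y), g, hU'o,
    hgc.isOpen_inter_preimage hNo hU'o, ⟨htU, by simpa [hp0] using htU₁⟩,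
    ⟨h0N, by rw [Set.mem_preimage, hp0]; exact ⟨htU, by simpa [hp0] using htU₁⟩⟩,
    fun y hy => AnalyticAt.fun_comp (f := pr) (hU₁ _ hy.2) (hpran y),
    fun s hs => hgan s (hN s hs.1).2.1 (hN s hs.1).2.2, ?_, ?_, ?_, ?_, fun s hs => (hN s hs.2.1).1⟩
  · rw [← hp0]
    exact (hN 0 h0N).1
  · intro y hy
    obtain ⟨s, hsN, hs, rfl⟩ := hpar y hy
    simp only [(hN s hsN).1]
    exact ⟨hs, hsN, hy.2⟩
  · rintro ⟨s₀, s₁⟩ ⟨hs, hsN, hsU⟩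
    refine ⟨?_, hsU⟩
    rcases mul_eq_zero.1 hs with e | e
    · simp only at e
      subst e
      rw [hg1]
      exact ⟨_, (hN _ hsN).2.2, rfl⟩
    · simp only at e
      subst e
      rw [hg0]
      exact ⟨_, (hN _ hsN).2.1, rfl⟩
  · intro y hy
    obtain ⟨s, hsN, hs, rfl⟩ := hpar y hy
    simp only [(hN s hsN).1]

end Germs

/-! ### Curves parametrized by `t ^ α * (t - 1) ^ β` -/

section MonomialCurve

/-- The curve with coordinates `c i * t ^ α i * (t - 1) ^ β i`: the image of the line
`x - y = 1` under a monomial map, in the coordinate `t = x`. -/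
noncomputable def monomialCurve {k : ℕ} (c : Fin k → ℂ) (α β : Fin k → ℤ) (t : ℂ) (i : Fin k) : ℂ :=
  c i * (t ^ α i * (t - 1) ^ β i)

variable {k : ℕ} {c : Fin k → ℂ} {α β : Fin k → ℤ}

lemma analyticAt_monomialCurve (c : Fin k → ℂ) {t : ℂ} (h0 : ∀ i, t ≠ 0 ∨ 0 ≤ α i) (h1 : t ≠ 1) :
    AnalyticAt ℂ (monomialCurve c α β) t := by
  refine AnalyticAt.pi fun i => analyticAt_const.mul (AnalyticAt.mul ?_ ?_)
  · rcases h0 i with h | h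
    · exact analyticAt_id.zpow h
    · exact analyticAt_id.zpow_nonneg h
  · exact (analyticAt_id.sub analyticAt_const).zpow (sub_ne_zero.2 h1)

lemma deriv_monomialCurve {t : ℂ} (h0 : t ≠ 0) (h1 : t ≠ 1) (i : Fin k) :
    deriv (fun t => monomialCurve c α β t i) t
      = monomialCurve c α β t i * (α i / t + β i / (t - 1)) := by
  have h1' := sub_ne_zero.2 h1
  have d1 := hasDerivAt_zpow (α i) t (Or.inl h0)
  have d2 : HasDerivAt (fun t : ℂ => (t - 1) ^ β i) (β i * (t - 1) ^ (β i - 1)) t :=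
    (hasDerivAt_zpow (β i) (t - 1) (Or.inl h1')).comp_sub_const t 1
  have := ((d1.mul d2).const_mul (c i)).deriv
  refine this.trans ?_
  rw [monomialCurve, zpow_sub_one₀ h0, zpow_sub_one₀ h1']
  field_simp

lemma monomialCurve_ne_zero (hc : ∀ i, c i ≠ 0) {t : ℂ} (h0 : t ≠ 0) (h1 : t ≠ 1) (i : Fin k) :
    monomialCurve c α β t i ≠ 0 :=
  mul_ne_zero (hc i) (mul_ne_zero (zpow_ne_zero _ h0) (zpow_ne_zero _ (sub_ne_zero.2 h1)))

/-- Two intersecting circles about `0` and `1` meet in conjugate points. -/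
lemma eq_or_eq_conj_of_norm_eq {s t : ℂ} (h0 : ‖t‖ = ‖s‖) (h1 : ‖t - 1‖ = ‖s - 1‖) :
    t = s ∨ t = starRingEnd ℂ s := by
  have e0 : Complex.normSq t = Complex.normSq s := by
    rw [Complex.normSq_eq_norm_sq, Complex.normSq_eq_norm_sq, h0]
  have e1 : Complex.normSq (t - 1) = Complex.normSq (s - 1) := by
    rw [Complex.normSq_eq_norm_sq, Complex.normSq_eq_norm_sq, h1]
  simp only [Complex.normSq_apply, Complex.sub_re, Complex.sub_im, Complex.one_re,
    Complex.one_im] at e0 e1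
  have hre : t.re = s.re := by linarith
  have him : (t.im - s.im) * (t.im + s.im) = 0 := by
    rw [hre] at e0
    linarith
  rcases mul_eq_zero.1 him with h | h
  · left; exact Complex.ext hre (by linarith)
  · right; exact Complex.ext (by simpa using hre) (by simp; linarith)

lemma norm_eq_of_const_mul_zpow_eq {c s t : ℂ} (hc : c ≠ 0) {m : ℤ} (hm : 0 < m)
    (h : c * t ^ m = c * s ^ m) : ‖t‖ = ‖s‖ := by
  have h' := congrArg norm (mul_left_cancel₀ hc h)
  lift m to ℕ using hm.le
  simp only [zpow_natCast, norm_pow] at h'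
  exact (pow_left_inj₀ (norm_nonneg _) (norm_nonneg _) (by omega)).1 h'

/-- Near `c * s ^ m`, the values of `c * t ^ m` bound `t` away from `0` and infinity. -/
lemma exists_nhds_norm_bound {c s : ℂ} (hc : c ≠ 0) (hs : s ≠ 0) {m : ℤ} (hm : 0 < m) :
    ∃ U ∈ 𝓝 (c * s ^ m), ∀ t : ℂ, c * t ^ m ∈ U → ‖s‖ / 2 ≤ ‖t‖ ∧ ‖t‖ ≤ 2 * ‖s‖ := by
  lift m to ℕ using hm.le
  have hm0 : m ≠ 0 := by omega
  have hs' := norm_pos_iff.2 hs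
  have hc' := norm_pos_iff.2 hc
  refine ⟨{y | ‖c‖ * (‖s‖ / 2) ^ m < ‖y‖ ∧ ‖y‖ < ‖c‖ * (2 * ‖s‖) ^ m}, ?_, ?_⟩
  · refine ((isOpen_lt continuous_const continuous_norm).inter
      (isOpen_lt continuous_norm continuous_const)).mem_nhds ⟨?_, ?_⟩
    · simp only [Set.mem_ofPred_eq, zpow_natCast, norm_mul, norm_pow]
      gcongr
      linarith
    · simp only [Set.mem_ofPred_eq, zpow_natCast, norm_mul, norm_pow]
      gcongr
      linarith
  · rintro t ⟨h1, h2⟩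
    simp only [zpow_natCast, norm_mul, norm_pow] at h1 h2
    exact ⟨(lt_of_pow_lt_pow_left₀ m (norm_nonneg _) (lt_of_mul_lt_mul_left h1 hc'.le)).le,
      (lt_of_pow_lt_pow_left₀ m (by positivity) (lt_of_mul_lt_mul_left h2 hc'.le)).le⟩

lemma isCompact_annulus (z : ℂ) (r R : ℝ) : IsCompact {t : ℂ | r ≤ ‖t - z‖ ∧ ‖t - z‖ ≤ R} := by
  refine (isCompact_closedBall z R).of_isClosed_subset ?_ ?_
  · have hc : Continuous fun t : ℂ => ‖t - z‖ := by fun_prop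
    exact (isClosed_le continuous_const hc).inter (isClosed_le hc continuous_const)
  · rintro t ⟨-, h⟩
    simpa [dist_eq_norm] using h

lemma exists_nhds_monomialCurve_right (hc : ∀ i, c i ≠ 0) {t₀ : ℂ} (h1 : t₀ ≠ 1) {q : Fin k}
    (hq : α q = 0) (hq' : 0 < β q) :
    ∃ U ∈ 𝓝 (monomialCurve c α β t₀), ∀ t, monomialCurve c α β t ∈ U →
      ‖t₀ - 1‖ / 2 ≤ ‖t - 1‖ ∧ ‖t - 1‖ ≤ 2 * ‖t₀ - 1‖ := by
  obtain ⟨U, hU, hUt⟩ := exists_nhds_norm_bound (hc q) (sub_ne_zero.2 h1) hq'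
  refine ⟨(fun y => y q) ⁻¹' U, (continuous_apply q).continuousAt.preimage_mem_nhds ?_,
    fun t ht => hUt (t - 1) ?_⟩
  · simpa [monomialCurve, hq] using hU
  · simpa [monomialCurve, hq] using ht

lemma exists_nhds_monomialCurve_left (hc : ∀ i, c i ≠ 0) {t₀ : ℂ} (h0 : t₀ ≠ 0) {p : Fin k}
    (hp : β p = 0) (hp' : 0 < α p) :
    ∃ U ∈ 𝓝 (monomialCurve c α β t₀), ∀ t, monomialCurve c α β t ∈ U →
      ‖t₀‖ / 2 ≤ ‖t‖ ∧ ‖t‖ ≤ 2 * ‖t₀‖ := by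
  obtain ⟨U, hU, hUt⟩ := exists_nhds_norm_bound (hc p) h0 hp'
  refine ⟨(fun y => y p) ⁻¹' U, (continuous_apply p).continuousAt.preimage_mem_nhds ?_,
    fun t ht => hUt t ?_⟩
  · simpa [monomialCurve, hp] using hU
  · simpa [monomialCurve, hp] using ht

/-- In the torus, the points of a monomial curve are smooth or nodes: the fibres consist of
conjugate parameters, and conjugate branches are transversal. -/
lemma germIso_monomialCurve (hc : ∀ i, c i ≠ 0) {i j p q : Fin k}
    (hij : α i * β j - α j * β i ≠ 0) (hp : β p = 0) (hp' : 0 < α p) (hq : α q = 0) (hq' : 0 < β q)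
    {t₀ : ℂ} (h0 : t₀ ≠ 0) (h1 : t₀ ≠ 1) :
    GermIso (monomialCurve c α β '' {t | t ≠ 0 ∧ t ≠ 1}) (monomialCurve c α β t₀)
        (Set.univ : Set ℂ) 0 ∨
      GermIso (monomialCurve c α β '' {t | t ≠ 0 ∧ t ≠ 1}) (monomialCurve c α β t₀)
        {c : ℂ × ℂ | c.1 * c.2 = 0} 0 := by
  set γ := monomialCurve c α β with hγ
  set D : Set ℂ := {t | t ≠ 0 ∧ t ≠ 1} with hD
  have hDo : IsOpen D := isOpen_ne.inter isOpen_ne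
  have han : AnalyticOnNhd ℂ γ D := fun t ht =>
    analyticAt_monomialCurve c (fun _ => Or.inl ht.1) ht.2
  have hprop : ProperNear γ D (γ t₀) := by
    obtain ⟨U, hU, hUt⟩ := exists_nhds_monomialCurve_left hc h0 hp hp'
    obtain ⟨V, hV, hVt⟩ := exists_nhds_monomialCurve_right hc h1 hq hq'
    refine ⟨U ∩ V, inter_mem hU hV, {t | ‖t₀‖ / 2 ≤ ‖t - 0‖ ∧ ‖t - 0‖ ≤ 2 * ‖t₀‖} ∩
      {t | ‖t₀ - 1‖ / 2 ≤ ‖t - 1‖ ∧ ‖t - 1‖ ≤ 2 * ‖t₀ - 1‖},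
      (isCompact_annulus _ _ _).inter (isCompact_annulus _ _ _), ?_, ?_⟩
    · rintro t ⟨⟨ha, -⟩, ⟨hb, -⟩⟩
      have h0' := norm_pos_iff.2 h0
      have h1' := norm_pos_iff.2 (sub_ne_zero.2 h1)
      refine ⟨?_, ?_⟩
      · rintro rfl
        rw [sub_self, norm_zero] at ha
        linarith
      · rintro rfl
        rw [sub_self, norm_zero] at hb
        linarith
    · rintro t - ⟨htU, htV⟩
      exact ⟨by simpa using hUt t htU, hVt t htV⟩
  have hfib : ∀ t ∈ D, γ t = γ t₀ → t = t₀ ∨ t = starRingEnd ℂ t₀ := by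
    intro t ht e
    refine eq_or_eq_conj_of_norm_eq ?_ ?_
    · refine norm_eq_of_const_mul_zpow_eq (hc p) hp' ?_
      simpa [hγ, monomialCurve, hp] using congrFun e p
    · refine norm_eq_of_const_mul_zpow_eq (hc q) hq' ?_
      simpa [hγ, monomialCurve, hq] using congrFun e q
  have hij' : (α i * β j - α j * β i : ℂ) ≠ 0 := by exact_mod_cast hij
  have h1' := sub_ne_zero.2 h1
  by_cases hcase : γ (starRingEnd ℂ t₀) = γ t₀ ∧ starRingEnd ℂ t₀ ≠ t₀
  · right
    obtain ⟨e, hne⟩ := hcase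
    set t₁ := starRingEnd ℂ t₀ with ht₁
    have h0t : t₁ ≠ 0 := by simpa [ht₁] using h0
    have h1t : t₁ ≠ 1 := fun h => h1 (by
      rw [← Complex.conj_conj t₀, ← ht₁, h, map_one])
    have h1t' := sub_ne_zero.2 h1t
    refine germIso_node_of_fiber_pair hDo han ⟨h0, h1⟩ ⟨h0t, h1t⟩ e hprop hfib i j ?_
    rw [deriv_monomialCurve h0 h1, deriv_monomialCurve h0t h1t, deriv_monomialCurve h0 h1,
      deriv_monomialCurve h0t h1t, ← hγ, e]
    have hγi : γ t₀ i ≠ 0 := monomialCurve_ne_zero hc h0 h1 i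
    have hγj : γ t₀ j ≠ 0 := monomialCurve_ne_zero hc h0 h1 j
    have key : γ t₀ i * (α i / t₀ + β i / (t₀ - 1)) * (γ t₀ j * (α j / t₁ + β j / (t₁ - 1)))
        - γ t₀ i * (α i / t₁ + β i / (t₁ - 1)) * (γ t₀ j * (α j / t₀ + β j / (t₀ - 1)))
        = γ t₀ i * γ t₀ j * (α i * β j - α j * β i) * (t₀ - t₁)
          / (t₀ * t₁ * (t₀ - 1) * (t₁ - 1)) := by
      field_simp
      ring
    rw [key]
    have hd : t₀ - t₁ ≠ 0 := sub_ne_zero.2 hne.symm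
    positivity
  · left
    have hfib' : ∀ t ∈ D, γ t = γ t₀ → t = t₀ := by
      intro t ht e
      rcases hfib t ht e with h | h
      · exact h
      · by_contra hne
        exact hcase ⟨h ▸ e, h ▸ hne⟩
    have hd : ∃ l, deriv (fun t => γ t l) t₀ ≠ 0 := by
      by_contra! hd
      have hz : ∀ l, α l * (t₀ - 1) + β l * t₀ = 0 := by
        intro l
        have := hd l
        rw [hγ, deriv_monomialCurve h0 h1] at this
        have := (mul_eq_zero.1 this).resolve_left (monomialCurve_ne_zero hc h0 h1 l)
        field_simp at this
        linear_combination this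
      apply mul_ne_zero hij' h0
      linear_combination α i * hz j - α j * hz i
    obtain ⟨l, hl⟩ := hd
    exact germIso_univ_of_fiber_subsingleton hDo han ⟨h0, h1⟩ hprop hfib' l hl

/-- The monomial curve is smooth at the parameter `0` if it extends over it, with a coordinate that
only vanishes there and a coordinate that is a power of `t - 1`. -/
lemma germIso_monomialCurve_zero (hc : ∀ i, c i ≠ 0) (hα : ∀ i, 0 ≤ α i) {p q : Fin k}
    (hp : 0 < α p) (hq : α q = 0) (hq' : 0 < β q) :
    GermIso (monomialCurve c α β '' {t | t ≠ 1}) (monomialCurve c α β 0)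
        (Set.univ : Set ℂ) 0 := by
  have h01 : (0 : ℂ) ≠ 1 := zero_ne_one
  refine germIso_univ_of_fiber_subsingleton isOpen_ne
    (fun t ht => analyticAt_monomialCurve c (fun i => Or.inr (hα i)) ht) h01 ?_ ?_ q ?_
  · obtain ⟨V, hV, hVt⟩ := exists_nhds_monomialCurve_right hc h01 hq hq'
    refine ⟨V, hV, _, isCompact_annulus _ _ _, ?_, fun t _ => hVt t⟩
    rintro t ⟨hb, -⟩ rfl
    norm_num at hb
  · intro t ht e
    have hp0 := congrFun e p
    by_contra h0
    refine monomialCurve_ne_zero (α := α) (β := β) hc h0 ht p (hp0.trans ?_)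
    rw [monomialCurve, zero_zpow _ hp.ne', zero_mul, mul_zero]
  · have d2 : HasDerivAt (fun t : ℂ => (t - 1) ^ β q) (β q * (0 - 1) ^ (β q - 1)) 0 :=
      (hasDerivAt_zpow (β q) ((0 : ℂ) - 1) (Or.inl (by simp))).comp_sub_const 0 1
    have h := (d2.const_mul (c q)).deriv
    have e : (fun t => monomialCurve c α β t q) = fun t => c q * (t - 1) ^ β q := by
      funext t
      simp [monomialCurve, hq]
    rw [e, h]
    exact mul_ne_zero (hc q) (mul_ne_zero (by exact_mod_cast hq'.ne')
      (zpow_ne_zero _ (by simp)))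

end MonomialCurve

/-! ### Normal form of a line -/

section NormalForm

variable {Δ : Fan 2} {φ : P1 → Δ.Variety} {u : Fin 3 → Fin 2 → ℤ} {w : Fin 3 → ℕ}

/-- The line `φ` of type `(u, w)` in a coordinate `t` in which it meets the divisors of `u 0`,
`u 1`, `u 2` at `0`, `1`, `∞`: the Laurent monomial `z^n` pulls back to
`χ n * t ^ (w 0 * ⟨n, u 0⟩) * (t - 1) ^ (w 1 * ⟨n, u 1⟩)`. -/
structure IsNormalForm (Δ : Fan 2) (φ : P1 → Δ.Variety) (u : Fin 3 → Fin 2 → ℤ) (w : Fin 3 → ℕ)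
    {a b : Fin 2 → ℂ} (h : a 0 * b 1 - a 1 * b 0 ≠ 0) (χ : (Fin 2 → ℤ) → ℂ) : Prop where
  mult_zero : HasLocalMultiplicity Δ φ (u 0) (affinePt h 0) (w 0)
  mult_one : HasLocalMultiplicity Δ φ (u 1) (affinePt h 1) (w 1)
  mult_infty : HasLocalMultiplicity Δ φ (u 2) (affinePt (det_swap_ne_zero h) 0) (w 2)
  mem_bigTorus : ∀ t, t ≠ 0 → t ≠ 1 → φ (affinePt h t) ∈ Δ.bigTorus
  coeff_ne_zero : ∀ n, χ n ≠ 0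
  laurent_eq : ∀ n t, t ≠ 0 → t ≠ 1 → Δ.laurent (φ (affinePt h t)) n =
    χ n * (t ^ (w 0 * ∑ i, n i * u 0 i) * (t - 1) ^ (w 1 * ∑ i, n i * u 1 i))

lemma HasType.exists_mem_divisor (ht : HasType Δ φ u w) (i : Fin 3) :
    ∃ q, φ q ∈ Δ.divisor (u i) := by
  have : u i ∈ Set.range u := ⟨i, rfl⟩
  rw [ht.2.1] at this
  exact this.2

/-- Positive local multiplicities with the divisors of distinct primitive vectors occur at distinct
points. -/
lemma eq_of_hasLocalMultiplicity {v v' : Fin 2 → ℤ} (hv : IsPrimitive v) (hv' : IsPrimitive v')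
    {k k' : ℕ} (hk : 0 < k) (hk' : 0 < k') {q : P1} (h : HasLocalMultiplicity Δ φ v q k)
    (h' : HasLocalMultiplicity Δ φ v' q k') : v = v' :=
  eq_of_halfPlane_le hv hv' fun _ hn =>
    (h'.mem_regularAt_iff hk').1 ((h.mem_regularAt_iff hk).2 hn)

lemma HasLocalMultiplicity.notMem_bigTorus {v : Fin 2 → ℤ} (hv : IsPrimitive v)
    {k : ℕ} (hk : 0 < k) {q : P1} (h : HasLocalMultiplicity Δ φ v q k) : φ q ∉ Δ.bigTorus := by
  intro hq
  obtain ⟨n, hn⟩ := exists_pairing_eq_one hv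
  have := (h.mem_regularAt_iff hk).1 (Fan.mem_regularAt_of_mem_bigTorus hq (-n))
  simp only [Pi.neg_apply, neg_mul, Finset.sum_neg_distrib, hn] at this
  omega

/-- The key step: a line is determined, up to coordinates and constants, by its type, since a
rational function on the projective line is determined up to a constant by its divisor. -/
lemma HasType.exists_isNormalForm (hu : ∀ i, IsPrimitive (u i)) (hw : ∀ i, 0 < w i)
    (huw : ∑ i, w i • u i = 0) (hφ : IsLine Δ φ) (ht : HasType Δ φ u w) :
    ∃ (a b : Fin 2 → ℂ) (h : a 0 * b 1 - a 1 * b 0 ≠ 0) (χ : (Fin 2 → ℤ) → ℂ),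
      IsNormalForm Δ φ u w h χ := by
  choose q hq using ht.exists_mem_divisor
  have hm : ∀ i, HasLocalMultiplicity Δ φ (u i) (q i) (w i) := fun i => ht.2.2 i (q i) (hq i)
  have hne : ∀ i j, i ≠ j → q i ≠ q j := fun i j hij e => hij <| ht.1 <|
    eq_of_hasLocalMultiplicity (hu i) (hu j) (hw i) (hw j) (hm i) (e ▸ hm j)
  have htor : ∀ p, (∀ i, p ≠ q i) → φ p ∈ Δ.bigTorus := by
    intro p hp
    rcases hφ.transverse.mem_bigTorus_or_mem_divisor p with h | ⟨v, hv, hpv⟩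
    · exact h
    · exfalso
      have : v ∈ Set.range u := by rw [ht.2.1]; exact ⟨hv, p, hpv⟩
      obtain ⟨i, rfl⟩ := this
      exact hp i (hφ.subsingleton _ hv hpv (hq i))
  obtain ⟨a, b, h, e0, e1, e2⟩ := exists_affinePt_normalized (hne 0 1 (by decide))
    (hne 0 2 (by decide)) (hne 1 2 (by decide))
  have m0 := hm 0
  have m1 := hm 1
  have m2 := hm 2
  rw [← e0] at m0
  rw [← e1] at m1
  rw [← e2] at m2
  have htor' : ∀ t, t ≠ 0 → t ≠ 1 → φ (affinePt h t) ∈ Δ.bigTorus := by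
    intro t h0 h1
    refine htor _ fun i => ?_
    fin_cases i
    · exact fun e => h0 (affinePt_injective h (e.trans e0.symm))
    · exact fun e => h1 (affinePt_injective h (e.trans e1.symm))
    · intro e
      have e' : affinePt h t = affinePt (det_swap_ne_zero h) 0 := e.trans e2.symm
      have : t⁻¹ = 0 := by
        apply affinePt_injective (det_swap_ne_zero h)
        rw [← e', affinePt_swap h (inv_ne_zero h0), inv_inv]
      exact h0 (inv_eq_zero.1 this)
  have key : ∀ n : Fin 2 → ℤ, ∃ c : ℂ, c ≠ 0 ∧ ∀ t, t ≠ 0 → t ≠ 1 →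
      Δ.laurent (φ (affinePt h t)) n =
        c * (t ^ (w 0 * ∑ i, n i * u 0 i) * (t - 1) ^ (w 1 * ∑ i, n i * u 1 i)) := by
    intro n
    refine exists_eq_const_mul_zpow (m0.hasMerOrder_laurent h n) (m1.hasMerOrder_laurent h n)
      (fun z h0 h1 => ⟨hφ.morphism.analyticAt_laurent h (htor' z h0 h1) n,
        Fan.laurent_ne_zero_of_mem_bigTorus (htor' z h0 h1) n⟩)
      (F := fun s => Δ.laurent (φ (affinePt (det_swap_ne_zero h) s)) n) ?_
      (fun s hs => by simp only [affinePt_swap h hs])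
    have := m2.hasMerOrder_laurent (det_swap_ne_zero h) n
    have e : (w 2 : ℤ) * ∑ i, n i * u 2 i
        = -(w 0 * ∑ i, n i * u 0 i) - w 1 * ∑ i, n i * u 1 i := by
      have c0 := congrFun huw 0
      have c1 := congrFun huw 1
      simp [Fin.sum_univ_three] at c0 c1
      simp only [Fin.sum_univ_two]
      linear_combination n 0 * c0 + n 1 * c1
    rwa [e] at this
  choose χ hχ0 hχ using key
  exact ⟨a, b, h, χ, m0, m1, m2, htor', hχ0, hχ⟩

namespace IsNormalForm

variable {a b : Fin 2 → ℂ} {h : a 0 * b 1 - a 1 * b 0 ≠ 0} {χ : (Fin 2 → ℤ) → ℂ}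

/-- The formula for the pulled back monomials extends to the point on the divisor of `u 0` for the
monomials that are regular there. -/
lemma laurent_eq_zero (hN : IsNormalForm Δ φ u w h χ) {n : Fin 2 → ℤ}
    (hn : 0 ≤ ∑ i, n i * u 0 i) : Δ.laurent (φ (affinePt h 0)) n =
      χ n * (0 ^ (w 0 * ∑ i, n i * u 0 i) * (0 - 1) ^ (w 1 * ∑ i, n i * u 1 i)) := by
  have c1 := (hN.mult_zero.analyticAt_laurent h hn).continuousAt
  have c2 : ContinuousAt (fun t : ℂ =>
      χ n * (t ^ (w 0 * ∑ i, n i * u 0 i) * (t - 1) ^ (w 1 * ∑ i, n i * u 1 i))) 0 := by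
    refine continuousAt_const.mul (ContinuousAt.mul ?_ ?_)
    · exact (continuousAt_zpow₀ _ _ (Or.inr (by positivity)))
    · exact (continuousAt_id.sub continuousAt_const).zpow₀ _ (Or.inl (by simp))
  refine (ContinuousAt.eventuallyEq_nhds_iff_eventuallyEq_nhdsNE c1 c2).1 ?_ |>.self_of_nhds
  filter_upwards [self_mem_nhdsWithin,
    nhdsWithin_le_nhds (isOpen_ne.mem_nhds (zero_ne_one (α := ℂ)))] with t h0 h1
  exact hN.laurent_eq n t h0 h1

end IsNormalForm

end NormalForm

/-! ### Generators of the dual monoids of the origin and of a ray -/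

section Generators

lemma zsmul_mem_of_mem_of_neg_mem {M : Type*} [AddCommGroup M] {S : AddSubmonoid M} {m : M}
    (h : m ∈ S) (h' : -m ∈ S) (k : ℤ) : k • m ∈ S := by
  rcases Int.eq_nat_or_neg k with ⟨l, rfl | rfl⟩
  · rw [natCast_zsmul]; exact nsmul_mem h l
  · rw [neg_smul, natCast_zsmul, ← smul_neg]; exact nsmul_mem h' l

/-- Generation of a submonoid can be checked in the ambient group. -/
lemma closure_range_eq_top {M : Type*} [AddCommGroup M] {S : AddSubmonoid M} {k : ℕ}
    {g : Fin k → S} (hg : ∀ n ∈ S, n ∈ AddSubmonoid.closure (Set.range fun i => (g i : M))) :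
    AddSubmonoid.closure (Set.range g) = ⊤ := by
  refine top_unique fun n _ => ?_
  have h1 : (AddSubmonoid.closure (Set.range g)).map S.subtype =
      AddSubmonoid.closure (Set.range fun i => (g i : M)) := by
    rw [AddMonoidHom.map_mclosure, ← Set.range_comp]
    rfl
  have h2 := hg n n.2
  rw [← h1] at h2
  obtain ⟨m, hm, e⟩ := h2
  have : m = n := Subtype.ext e
  exact this ▸ hm

lemma eq_zsmul_quarterTurn {v n : Fin 2 → ℤ} (hv : IsPrimitive v) (hn : ∑ i, n i * v i = 0) :
    ∃ l : ℤ, n = l • quarterTurn v := by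
  obtain ⟨r, s, hrs⟩ := isPrimitive_iff_isCoprime.1 hv
  rw [Fin.sum_univ_two] at hn
  refine ⟨r * n 1 - s * n 0, funext fun i => ?_⟩
  fin_cases i
  · show n 0 = (r * n 1 - s * n 0) * -v 1
    linear_combination -n 0 * hrs + r * hn
  · show n 1 = (r * n 1 - s * n 0) * v 0
    linear_combination -n 1 * hrs + s * hn

lemma pairing_quarterTurn (v v' : Fin 2 → ℤ) (k : ℤ) :
    ∑ i, (k • quarterTurn v) i * v' i = k * (v 0 * v' 1 - v 1 * v' 0) := by
  simp [quarterTurn, Fin.sum_univ_two]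
  ring

end Generators

/-! ### The germs of the image -/

section Germs

variable {Δ : Fan 2} {φ : P1 → Δ.Variety} {u : Fin 3 → Fin 2 → ℤ} {w : Fin 3 → ℕ}
  {a b : Fin 2 → ℂ} {h : a 0 * b 1 - a 1 * b 0 ≠ 0} {χ : (Fin 2 → ℤ) → ℂ}

/-- The exponents `m * ⟨g i, v⟩` with which the monomials of the family `g` enter the normal form of a
line, for a ray `v` met with multiplicity `m`. -/
def exponent {k : ℕ} (g : Fin k → Fin 2 → ℤ) (v : Fin 2 → ℤ) (m : ℕ) (i : Fin k) : ℤ :=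
  m * ∑ j, g i j * v j

/-- The image of `φ` in a chart, embedded by monomials and parametrized by the part `D` of the affine
coordinate that `φ` sends into the chart. -/
lemma image_chart_eq {k : ℕ} (σ : Δ.cones) (g : Fin k → dualMonoid σ.1) {D : Set ℂ}
    {γ : ℂ → Fin k → ℂ}
    (hγ : ∀ t ∈ D, ∀ i, Δ.laurent (φ (affinePt h t)) (g i) = γ t i)
    (hD : ∀ t ∈ D, ∃ y, Δ.chart σ y = φ (affinePt h t))
    (hD' : ∀ y q, Δ.chart σ y = φ q → ∃ t ∈ D, q = affinePt h t) :
    (fun (y : Affine σ.1) (i : Fin k) => y.monomial (g i)) '' {y | Δ.chart σ y ∈ Set.range φ}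
      = γ '' D := by
  ext z
  constructor
  · rintro ⟨y, ⟨q, hq⟩, rfl⟩
    obtain ⟨t, ht, rfl⟩ := hD' y q hq.symm
    refine ⟨t, ht, funext fun i => ?_⟩
    rw [← hγ t ht, hq]
    exact Fan.laurent_chart σ y (g i)
  · rintro ⟨t, ht, rfl⟩
    obtain ⟨y, hy⟩ := hD t ht
    refine ⟨y, ⟨_, hy.symm⟩, funext fun i => ?_⟩
    rw [← hγ t ht, ← hy]
    exact (Fan.laurent_chart σ y (g i)).symm

lemma hasGerm_of_germIso {F : Type*} [NormedAddCommGroup F] [NormedSpace ℂ F] {Z : Set F} {z : F}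
    {k : ℕ} (σ : Δ.cones) (g : Fin k → dualMonoid σ.1)
    (hg : AddSubmonoid.closure (Set.range g) = ⊤) {D : Set ℂ} {γ : ℂ → Fin k → ℂ}
    (hγ : ∀ t ∈ D, ∀ i, Δ.laurent (φ (affinePt h t)) (g i) = γ t i)
    (hD : ∀ t ∈ D, ∃ y, Δ.chart σ y = φ (affinePt h t))
    (hD' : ∀ y q, Δ.chart σ y = φ q → ∃ t ∈ D, q = affinePt h t) {t₀ : ℂ} (ht₀ : t₀ ∈ D)
    (hiso : GermIso (γ '' D) (γ t₀) Z z) :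
    HasGerm Δ (Set.range φ) (φ (affinePt h t₀)) Z z := by
  obtain ⟨y, hy⟩ := hD t₀ ht₀
  refine ⟨σ, y, k, g, hy, hg, ?_⟩
  rw [image_chart_eq σ g hγ hD hD']
  have : (fun i => y.monomial (g i)) = γ t₀ := funext fun i => by
    rw [← hγ t₀ ht₀, ← hy]
    exact (Fan.laurent_chart σ y (g i)).symm
  rw [this]
  exact hiso

/-- At a point of the big torus, the image of a line is smooth or has a node. -/
lemma IsNormalForm.isSmoothPoint_or_isNode (hN : IsNormalForm Δ φ u w h χ)
    (hu : ∀ i, IsPrimitive (u i)) (hw : ∀ i, 0 < w i)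
    (hdet : u 0 0 * u 1 1 - u 0 1 * u 1 0 ≠ 0) {t₀ : ℂ} (h0 : t₀ ≠ 0) (h1 : t₀ ≠ 1) :
    IsSmoothPoint Δ (Set.range φ) (φ (affinePt h t₀)) ∨
      IsNode Δ (Set.range φ) (φ (affinePt h t₀)) := by
  obtain ⟨hbot, -, -⟩ := Fan.exists_chart_bot_of_mem_bigTorus (hN.mem_bigTorus t₀ h0 h1)
  set d := u 0 0 * u 1 1 - u 0 1 * u 1 0 with hd
  -- The last two generators are redundant: they pull back to powers of `t` and of `t - 1`.
  set g : Fin 6 → Fin 2 → ℤ := ![![1, 0], ![0, 1], -![1, 0], -![0, 1],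
    (-d) • quarterTurn (u 1), d • quarterTurn (u 0)] with hg
  have hgen : AddSubmonoid.closure (Set.range fun i =>
      (⟨g i, mem_dualMonoid_bot _⟩ : dualMonoid (⊥ : PointedCone ℝ (Fin 2 → ℝ)))) = ⊤ := by
    refine closure_range_eq_top fun n _ => ?_
    have hmem : ∀ i, g i ∈ AddSubmonoid.closure (Set.range g) := fun i =>
      AddSubmonoid.subset_closure ⟨i, rfl⟩
    have : n = n 0 • g 0 + n 1 • g 1 := by
      funext i
      fin_cases i <;> simp [hg]
    rw [this]
    exact add_mem (zsmul_mem_of_mem_of_neg_mem (hmem 0) (hmem 2) _)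
      (zsmul_mem_of_mem_of_neg_mem (hmem 1) (hmem 3) _)
  have hw0 : (0 : ℤ) < w 0 := by exact_mod_cast hw 0
  have hw1 : (0 : ℤ) < w 1 := by exact_mod_cast hw 1
  have hd2 : 0 < d * d := mul_self_pos.2 hdet
  have p4 : ∀ v : Fin 2 → ℤ, ∑ j, g 4 j * v j = -d * (u 1 0 * v 1 - u 1 1 * v 0) := fun v =>
    pairing_quarterTurn (u 1) v (-d)
  have p5 : ∀ v : Fin 2 → ℤ, ∑ j, g 5 j * v j = d * (u 0 0 * v 1 - u 0 1 * v 0) := fun v =>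
    pairing_quarterTurn (u 0) v d
  have key := germIso_monomialCurve (c := fun i => χ (g i)) (α := exponent g (u 0) (w 0))
    (β := exponent g (u 1) (w 1)) (fun i => hN.coeff_ne_zero _) (i := 0) (j := 1) (p := 4) (q := 5)
    (by
      have : exponent g (u 0) (w 0) 0 * exponent g (u 1) (w 1) 1
          - exponent g (u 0) (w 0) 1 * exponent g (u 1) (w 1) 0 = w 0 * w 1 * d := by
        simp [exponent, hg, Fin.sum_univ_two, hd]
        ring
      rw [this]
      positivity)
    (by rw [exponent, p4]; ring)
    (by
      rw [exponent, p4]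
      have : (w 0 : ℤ) * (-d * (u 1 0 * u 0 1 - u 1 1 * u 0 0)) = w 0 * (d * d) := by
        rw [hd]; ring
      rw [this]; positivity)
    (by rw [exponent, p5]; ring)
    (by
      rw [exponent, p5, ← hd]; positivity) h0 h1
  have hγ : ∀ t ∈ {t : ℂ | t ≠ 0 ∧ t ≠ 1}, ∀ i, Δ.laurent (φ (affinePt h t)) (g i) =
      monomialCurve (fun i => χ (g i)) (exponent g (u 0) (w 0)) (exponent g (u 1) (w 1)) t i :=
    fun t ht i => hN.laurent_eq _ t ht.1 ht.2
  have hD : ∀ t ∈ {t : ℂ | t ≠ 0 ∧ t ≠ 1}, ∃ y, Δ.chart ⟨⊥, hbot⟩ y = φ (affinePt h t) := by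
    rintro t ⟨h0, h1⟩
    obtain ⟨_, y, hy⟩ := Fan.exists_chart_bot_of_mem_bigTorus (hN.mem_bigTorus t h0 h1)
    exact ⟨y, hy.symm⟩
  have hD' : ∀ y q, Δ.chart ⟨⊥, hbot⟩ y = φ q →
      ∃ t ∈ {t : ℂ | t ≠ 0 ∧ t ≠ 1}, q = affinePt h t := by
    intro y q hq
    have hT : φ q ∈ Δ.bigTorus := hq ▸ Fan.chart_bot_mem_bigTorus hbot y
    rcases exists_affinePt_eq h q with ⟨t, rfl⟩ | rfl
    · refine ⟨t, ⟨?_, ?_⟩, rfl⟩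
      · rintro rfl
        exact hN.mult_zero.notMem_bigTorus (hu 0) (hw 0) hT
      · rintro rfl
        exact hN.mult_one.notMem_bigTorus (hu 1) (hw 1) hT
    · exact absurd hT (hN.mult_infty.notMem_bigTorus (hu 2) (hw 2))
  exact key.imp (hasGerm_of_germIso ⟨⊥, hbot⟩ _ hgen hγ hD hD' ⟨h0, h1⟩)
    (hasGerm_of_germIso ⟨⊥, hbot⟩ _ hgen hγ hD hD' ⟨h0, h1⟩)

/-- At its point on the divisor of `u 0`, the image of a line is smooth. -/
lemma IsNormalForm.isSmoothPoint_zero (hN : IsNormalForm Δ φ u w h χ)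
    (hu : ∀ i, IsPrimitive (u i)) (hw : ∀ i, 0 < w i) (hinj : Function.Injective u)
    (hdet : u 0 0 * u 1 1 - u 0 1 * u 1 0 ≠ 0) :
    IsSmoothPoint Δ (Set.range φ) (φ (affinePt h 0)) := by
  obtain ⟨hray, W, x, -, hq, -, hx, -⟩ := id hN.mult_zero
  set d := u 0 0 * u 1 1 - u 0 1 * u 1 0 with hd
  obtain ⟨n, hn⟩ := exists_pairing_eq_one (hu 0)
  have p0 : ∀ k : ℤ, ∑ i, (k • quarterTurn (u 0)) i * u 0 i = 0 := fun k => by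
    rw [pairing_quarterTurn]; ring
  -- The last generator is redundant: it pulls back to a power of `t - 1`.
  set g : Fin 4 → Fin 2 → ℤ := ![n, (1 : ℤ) • quarterTurn (u 0), (-1 : ℤ) • quarterTurn (u 0),
    d • quarterTurn (u 0)] with hg
  have hg0 : ∀ i, 0 ≤ ∑ j, g i j * u 0 j := by
    intro i
    fin_cases i
    · exact hn.ge.trans' zero_le_one
    · exact (p0 1).ge
    · exact (p0 (-1)).ge
    · exact (p0 d).ge
  have hgen : AddSubmonoid.closure (Set.range fun i =>
      (⟨g i, mem_dualMonoid_ray.2 (hg0 i)⟩ : dualMonoid (ray (u 0)))) = ⊤ := by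
    refine closure_range_eq_top fun m hm => ?_
    have hmem : ∀ i, g i ∈ AddSubmonoid.closure (Set.range g) := fun i =>
      AddSubmonoid.subset_closure ⟨i, rfl⟩
    obtain ⟨k, hk⟩ := Int.eq_ofNat_of_zero_le (mem_dualMonoid_ray.1 hm)
    obtain ⟨l, hl⟩ := eq_zsmul_quarterTurn (hu 0) (pairing_sub_smul (m := m) hn)
    rw [hk, natCast_zsmul, sub_eq_iff_eq_add'] at hl
    rw [hl]
    have h2 : -quarterTurn (u 0) = g 2 := (neg_one_smul ℤ _).symm
    have h1 : quarterTurn (u 0) = g 1 := (one_smul ℤ _).symm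
    exact add_mem (nsmul_mem (hmem 0) k)
      (zsmul_mem_of_mem_of_neg_mem (h1 ▸ hmem 1) (h2 ▸ hmem 2) l)
  have hw0 : (0 : ℤ) < w 0 := by exact_mod_cast hw 0
  have hw1 : (0 : ℤ) < w 1 := by exact_mod_cast hw 1
  have hd2 : 0 < d * d := mul_self_pos.2 hdet
  have p3 : ∀ v : Fin 2 → ℤ, ∑ j, g 3 j * v j = d * (u 0 0 * v 1 - u 0 1 * v 0) := fun v =>
    pairing_quarterTurn (u 0) v d
  have key := germIso_monomialCurve_zero (c := fun i => χ (g i))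
    (α := exponent g (u 0) (w 0)) (β := exponent g (u 1) (w 1)) (fun i => hN.coeff_ne_zero _)
    (fun i => mul_nonneg hw0.le (hg0 i)) (p := 0) (q := 3)
    (by
      have : ∑ j, g 0 j * u 0 j = 1 := hn
      rw [exponent, this]; positivity)
    (by rw [exponent, p3]; ring)
    (by rw [exponent, p3, ← hd]; positivity)
  refine hasGerm_of_germIso ⟨ray (u 0), hray⟩ _ hgen (D := {t : ℂ | t ≠ 1}) ?_ ?_ ?_
    (zero_ne_one (α := ℂ)) key
  · intro t ht i
    by_cases h0 : t = 0
    · subst h0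
      exact hN.laurent_eq_zero (hg0 i)
    · exact hN.laurent_eq _ t h0 ht
  · intro t ht
    by_cases h0 : t = 0
    · subst h0
      exact ⟨_, (hx _ hq).symm⟩
    · obtain ⟨hbot, y, hy⟩ := Fan.exists_chart_bot_of_mem_bigTorus (hN.mem_bigTorus t h0 ht)
      exact ⟨_, (Fan.chart_extend (σ := ⟨ray (u 0), hray⟩) (τ := ⟨⊥, hbot⟩) bot_le y).trans hy.symm⟩
  · intro y q hyq
    have hreg : ∀ m : Fin 2 → ℤ, 0 ≤ ∑ i, m i * u 0 i → m ∈ Δ.regularAt (φ q) := by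
      intro m hm
      rw [← hyq]
      exact Fan.mem_regularAt ⟨ray (u 0), hray⟩ y ⟨m, mem_dualMonoid_ray.2 hm⟩
    have hnot : ∀ i, i ≠ 0 → ¬ HasLocalMultiplicity Δ φ (u i) q (w i) := fun i hi hm =>
      hi (hinj (eq_of_halfPlane_le (hu 0) (hu i) fun m hm' =>
        (hm.mem_regularAt_iff (hw i)).1 (hreg m hm'))).symm
    rcases exists_affinePt_eq h q with ⟨t, rfl⟩ | rfl
    · refine ⟨t, ?_, rfl⟩
      rintro rfl
      exact hnot 1 (by decide) hN.mult_one
    · exact absurd hN.mult_infty (hnot 2 (by decide))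

lemma HasType.comp_equiv (ht : HasType Δ φ u w) (e : Equiv.Perm (Fin 3)) :
    HasType Δ φ (u ∘ e) (w ∘ e) :=
  ⟨ht.1.comp e.injective, by rw [e.surjective.range_comp]; exact ht.2.1,
    fun i q hq => ht.2.2 (e i) q hq⟩

lemma HasType.isSmoothPoint_of_mem_divisor (hu : ∀ i, IsPrimitive (u i)) (hw : ∀ i, 0 < w i)
    (huw : ∑ i, w i • u i = 0) (hφ : IsLine Δ φ) (ht : HasType Δ φ u w) {q : P1} {i : Fin 3}
    (hq : φ q ∈ Δ.divisor (u i)) : IsSmoothPoint Δ (Set.range φ) (φ q) := by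
  -- By symmetry the divisor may be taken to be that of `u 0`.
  set e := Equiv.swap 0 i with he
  have ht' := ht.comp_equiv e
  have hsum : ∑ j, (w ∘ e) j • (u ∘ e) j = 0 := by
    rw [← huw]
    exact Equiv.sum_comp e fun j => w j • u j
  have hu' : ∀ j, IsPrimitive ((u ∘ e) j) := fun j => hu (e j)
  have hw' : ∀ j, 0 < (w ∘ e) j := fun j => hw (e j)
  obtain ⟨a, b, h, χ, hN⟩ := ht'.exists_isNormalForm hu' hw' hsum hφ
  have hsm := hN.isSmoothPoint_zero hu' hw' ht'.1 (det_ne_zero_of_relation hu' hw' hsum ht'.1)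
  have hq' : HasLocalMultiplicity Δ φ (u i) q (w i) := ht.2.2 i q hq
  have h0i : (u ∘ e) 0 = u i := by simp [he]
  have hnot : ∀ j, j ≠ 0 → ¬ HasLocalMultiplicity Δ φ ((u ∘ e) j) q ((w ∘ e) j) := fun j hj hm =>
    hj (ht'.1 ((eq_of_hasLocalMultiplicity (hu' j) (hu i) (hw' j) (hw i) hm hq').trans h0i.symm))
  rcases exists_affinePt_eq h q with ⟨t, rfl⟩ | rfl
  · by_cases h0 : t = 0
    · rwa [h0]
    by_cases h1 : t = 1
    · subst h1
      exact absurd hN.mult_one (hnot 1 (by decide))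
    exact absurd (hN.mem_bigTorus t h0 h1) (hq'.notMem_bigTorus (hu i) (hw i))
  · exact absurd hN.mult_infty (hnot 2 (by decide))

end Germs

end Toric

/-- All singularities of the image of a trivalent line in a complete toric surface are nodes, and
they lie in the big torus orbit. -/
theorem mainTheorem8 (Δ : Toric.Fan 2) (hΔ : Δ.IsComplete)
    (u : Fin 3 → Fin 2 → ℤ) (w : Fin 3 → ℕ)
    (hu : ∀ i, Toric.IsPrimitive (u i)) (hw : ∀ i, 0 < w i) (huw : ∑ i, w i • u i = 0)
    (φ : Toric.P1 → Δ.Variety) (hφ : Toric.IsLine Δ φ) (htype : Toric.HasType Δ φ u w) :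
    ∀ p, Toric.IsSingularPoint Δ (Set.range φ) p →
      Toric.IsNode Δ (Set.range φ) p ∧ p ∈ Δ.bigTorus := by
  rintro _ ⟨⟨q, rfl⟩, hq⟩
  obtain ⟨a, b, h, χ, hN⟩ := htype.exists_isNormalForm hu hw huw hφ
  have hT : φ q ∈ Δ.bigTorus := by
    rcases hφ.transverse.mem_bigTorus_or_mem_divisor q with hT | ⟨v, hv, hqv⟩
    · exact hT
    · have : v ∈ Set.range u := by rw [htype.2.1]; exact ⟨hv, q, hqv⟩
      obtain ⟨i, rfl⟩ := this
      exact absurd (htype.isSmoothPoint_of_mem_divisor hu hw huw hφ hqv) hq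
  refine ⟨?_, hT⟩
  rcases Toric.exists_affinePt_eq h q with ⟨t, rfl⟩ | rfl
  · have h0 : t ≠ 0 := by
      rintro rfl
      exact hN.mult_zero.notMem_bigTorus (hu 0) (hw 0) hT
    have h1 : t ≠ 1 := by
      rintro rfl
      exact hN.mult_one.notMem_bigTorus (hu 1) (hw 1) hT
    exact (hN.isSmoothPoint_or_isNode hu hw
      (Toric.det_ne_zero_of_relation hu hw huw htype.1) h0 h1).resolve_left hq
  · exact absurd hT (hN.mult_infty.notMem_bigTorus (hu 2) (hw 2))
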